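/- Let $n,m,c\ge 0$ and $r\ge 1$ be integers, let $B^n\subset\mathbb{R}^n$ be the open unit ball, and let $C^r(\bar B^n,\mathbb{R}^m)$ be the separable Banach space of maps that are $C^r$ on $B^n$ and whose differentials of order $\le r$ extend continuously to the closed ball $\bar B^n$, with norm the sum over $0\le k\le r$ of the suprema of the norms of the $k$-th differentials. Let $A\subset\mathbb{R}^m$ be a smooth (embedded, not necessarily closed) submanifold of codimension $c$. Let $NA\subset C^r(\bar B^n,\mathbb{R}^m)$ be the set of maps $f$ which are not transverse to $A$ on $B^n$, i.e. for which there is $x\in B^n$ with $f(x)\in A$ and $df_x(\mathbb{R}^n)+T_{f(x)}A\ne\mathbb{R}^m$. 1. If $r\ge n-c+1$, then $NA$ is Baire meager and Aronszajn null (hence Haar null) in $C^r(\bar B^n,\mathbb{R}^m)$. 2. If $r\ge 2$, then $NA$ is rectifiable of positive codimension in $C^r(\bar B^n,\mathbb{R}^m)$; it is thus Baire meager and Aronszajn null. Here a subset $S$ of a separable Banach space $F$ is called - *Baire meager* if it is contained in a countable union of closed sets with empty interior; - *Aronszajn null* if for each sequence $(f_k)$ in $F$ with dense linear span there are Borel sets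 $S_k$ with $S\subset\bigcup_k S_k$ such that, for all $f\in F$ and all $k$, the set $\{x\in\mathbb{R}: f+xf_k\in S_k\}$ has Lebesgue measure zero; - *Haar null* if there is a Borel probability measure $\mu$ on $F$ such that, for each $f\in F$, the set $S+f$ is contained in a Borel set of $\mu$-measure zero; - a *Lipschitz graph of codimension $d$* if there are a topological splitting $F=E\oplus G$ with $\dim G=d$ and a Lipschitz map $g:E\to G$ such that $S\subset\{x+g(x):x\in E\}$; - *rectifiable of codimension $d$* if it is a countable union $S=\bigcup_k\varphi_k(S_k)$, where each $\varphi_k:U_k\to F$ is a $C^1$ map on an open subset $U_k$ of a separable Banach space $F_k$ whose differential is, at every point, a Fredholm operator of the same index $i_k$, and $S_k\subset U_k$ is a Lipschitz graph of codimension $d+i_k$ in $F_k$; it is *rectifiable of positive codimension* if this holds for some integer $d\ge 1$. -/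

import Mathlib

open Set Filter Topology MeasureTheory
open scoped ContDiff

noncomputable section

/-! ### The Banach space `C^r(B̄ⁿ, ℝᵐ)` -/

section CrSpace

variable (V W : Type) [NormedAddCommGroup V] [NormedSpace ℝ V] [ProperSpace V]
  [NormedAddCommGroup W] [NormedSpace ℝ W] (r : ℕ)

/-- The ambient space of families `(u₀, …, u_r)`, where `u_k` is a continuous map from the closed
unit ball of `V` to the `k`-linear maps `V^k → W`.  Each factor `C(B̄, _)` carries the sup norm, and
the norm of the product is the sum of these sup norms. -/
def JetFamily : Type :=
  PiLp 1 fun k : Fin (r + 1) =>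
    C(Metric.closedBall (0 : V) 1, ContinuousMultilinearMap ℝ (fun _ : Fin (k : ℕ) => V) W)

instance : NormedAddCommGroup (JetFamily V W r) :=
  inferInstanceAs (NormedAddCommGroup (PiLp 1 fun k : Fin (r + 1) =>
    C(Metric.closedBall (0 : V) 1, ContinuousMultilinearMap ℝ (fun _ : Fin (k : ℕ) => V) W)))

instance : NormedSpace ℝ (JetFamily V W r) :=
  inferInstanceAs (NormedSpace ℝ (PiLp 1 fun k : Fin (r + 1) =>
    C(Metric.closedBall (0 : V) 1, ContinuousMultilinearMap ℝ (fun _ : Fin (k : ℕ) => V) W)))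

variable {V W r}

/-- The component `u_k` of a family `u = (u₀, …, u_r)`. -/
def JetFamily.comp (u : JetFamily V W r) (k : Fin (r + 1)) :
    C(Metric.closedBall (0 : V) 1, ContinuousMultilinearMap ℝ (fun _ : Fin (k : ℕ) => V) W) :=
  WithLp.ofLp u k

open Classical in
/-- The map underlying a family `(u₀, …, u_r)`: it is `u₀` on the closed unit ball (a `0`-linear
map being identified with its value), extended by the irrelevant value `0` outside. -/
def JetFamily.toMap (u : JetFamily V W r) (x : V) : W :=
  if h : x ∈ Metric.closedBall (0 : V) 1 then (u.comp 0 ⟨x, h⟩) 0 else 0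

/-- The family `u` consists of a map that is `C^r` on the open unit ball, together with continuous
extensions to the closed ball of its differentials of all orders `k ≤ r`. -/
def JetFamily.IsCr (u : JetFamily V W r) : Prop :=
  ContDiffOn ℝ r u.toMap (Metric.ball 0 1) ∧
    ∀ (k : Fin (r + 1)) (x : Metric.closedBall (0 : V) 1), (x : V) ∈ Metric.ball (0 : V) 1 →
      u.comp k x = iteratedFDeriv ℝ (k : ℕ) u.toMap x

theorem JetFamily.toMap_zero : (0 : JetFamily V W r).toMap = 0 := by
  funext x
  by_cases h : x ∈ Metric.closedBall (0 : V) 1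
  · simp only [JetFamily.toMap, dif_pos h]; rfl
  · simp only [JetFamily.toMap, dif_neg h]; rfl

theorem JetFamily.toMap_add (u v : JetFamily V W r) : (u + v).toMap = u.toMap + v.toMap := by
  funext x
  by_cases h : x ∈ Metric.closedBall (0 : V) 1
  · simp only [JetFamily.toMap, Pi.add_apply, dif_pos h]; rfl
  · simp only [JetFamily.toMap, Pi.add_apply, dif_neg h, add_zero]

theorem JetFamily.toMap_smul (a : ℝ) (u : JetFamily V W r) : (a • u).toMap = a • u.toMap := by
  funext x
  by_cases h : x ∈ Metric.closedBall (0 : V) 1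
  · simp only [JetFamily.toMap, Pi.smul_apply, dif_pos h]; rfl
  · simp only [JetFamily.toMap, Pi.smul_apply, dif_neg h, smul_zero]

theorem JetFamily.IsCr.contDiffAt {u : JetFamily V W r} (hu : u.IsCr) (k : Fin (r + 1)) {x : V}
    (hx : x ∈ Metric.ball 0 1) : ContDiffAt ℝ ((k : ℕ) : WithTop ℕ∞) u.toMap x := by
  refine (hu.1.contDiffAt (Metric.isOpen_ball.mem_nhds hx)).of_le ?_
  exact_mod_cast Nat.lt_succ_iff.mp k.2

variable (V W r)

/-- The space of maps from the closed unit ball of `V` to `W` that are `C^r` on the open unit ball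
and whose differentials of order `≤ r` extend continuously to the closed ball, as a linear subspace
of the space of families `(u₀, …, u_r)`: a map is recorded together with the (unique) continuous
extensions of its differentials. -/
def crSubmodule : Submodule ℝ (JetFamily V W r) where
  carrier := {u | u.IsCr}
  zero_mem' := by
    refine ⟨?_, ?_⟩
    · rw [JetFamily.toMap_zero]; exact contDiffOn_const
    · intro k x _
      rw [JetFamily.toMap_zero, Pi.zero_def, iteratedFDeriv_fun_zero]; rfl
  add_mem' := by
    intro u v hu hv
    refine ⟨?_, ?_⟩
    · rw [JetFamily.toMap_add]; exact hu.1.add hv.1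
    · intro k x hx
      rw [JetFamily.toMap_add, iteratedFDeriv_add_apply (hu.contDiffAt k hx) (hv.contDiffAt k hx),
        ← hu.2 k x hx, ← hv.2 k x hx]
      rfl
  smul_mem' := by
    intro a u hu
    refine ⟨?_, ?_⟩
    · rw [JetFamily.toMap_smul]; exact hu.1.const_smul a
    · intro k x hx
      rw [JetFamily.toMap_smul, iteratedFDeriv_const_smul_apply (hu.contDiffAt k hx),
        ← hu.2 k x hx]
      rfl

/-- The type of maps from the closed unit ball of `V` to `W` that are `C^r` on the open ball with
differentials of order `≤ r` that extend continuously to the closed ball. -/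
def CrSpace : Type := crSubmodule V W r

/-- The norm of `CrSpace V W r` is the sum over `k ≤ r` of the suprema of the norms of the `k`-th
differentials. -/
instance : NormedAddCommGroup (CrSpace V W r) :=
  inferInstanceAs (NormedAddCommGroup (crSubmodule V W r))

instance : NormedSpace ℝ (CrSpace V W r) :=
  inferInstanceAs (NormedSpace ℝ (crSubmodule V W r))

variable {V W r}

/-- The map `V → W` underlying `f` (only its values on the closed unit ball are meaningful). -/
def CrSpace.toMap (f : CrSpace V W r) : V → W := JetFamily.toMap f.1

end CrSpace

/-- `C^r(B̄ⁿ, ℝᵐ)` as a normed space. -/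
abbrev CrBall (n m r : ℕ) : Type :=
  CrSpace (EuclideanSpace ℝ (Fin n)) (EuclideanSpace ℝ (Fin m)) r

/-! ### Submanifolds of `ℝᵐ` and transversality -/

/-- `A` is a smooth (embedded, not necessarily closed) submanifold of `ℝᵐ` of codimension `c`:
near each of its points, it is the zero set of a smooth submersion to `ℝᶜ`. -/
def IsSmoothSubmanifold {m : ℕ} (A : Set (EuclideanSpace ℝ (Fin m))) (c : ℕ) : Prop :=
  ∀ y ∈ A, ∃ (U : Set (EuclideanSpace ℝ (Fin m)))
    (g : EuclideanSpace ℝ (Fin m) → EuclideanSpace ℝ (Fin c)),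
    IsOpen U ∧ y ∈ U ∧ ContDiffOn ℝ ∞ g U ∧
      (∀ z ∈ U, Function.Surjective (fderiv ℝ g z)) ∧ A ∩ U = {z ∈ U | g z = 0}

/-- The tangent space `T_y A`: the velocities at time `0` of the `C¹` curves in `A` that pass
through `y` at time `0`. -/
def tangentVectors {m : ℕ} (A : Set (EuclideanSpace ℝ (Fin m))) (y : EuclideanSpace ℝ (Fin m)) :
    Set (EuclideanSpace ℝ (Fin m)) :=
  {v | ∃ γ : ℝ → EuclideanSpace ℝ (Fin m),
    ContDiffAt ℝ 1 γ 0 ∧ γ 0 = y ∧ (∀ᶠ t in 𝓝 0, γ t ∈ A) ∧ deriv γ 0 = v}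

/-- The map `f` is transverse to `A` on the open unit ball `Bⁿ`: at each `x ∈ Bⁿ` such that
`f x ∈ A`, one has `df_x(ℝⁿ) + T_{f x} A = ℝᵐ`. -/
def IsTransverseOnBall {n m r : ℕ} (f : CrBall n m r) (A : Set (EuclideanSpace ℝ (Fin m))) :
    Prop :=
  ∀ x ∈ Metric.ball (0 : EuclideanSpace ℝ (Fin n)) 1, f.toMap x ∈ A →
    ∀ w : EuclideanSpace ℝ (Fin m), ∃ v : EuclideanSpace ℝ (Fin n),
      ∃ t ∈ tangentVectors A (f.toMap x), fderiv ℝ f.toMap x v + t = w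

/-- The set `NA ⊆ C^r(B̄ⁿ, ℝᵐ)` of the maps that are not transverse to `A` on `Bⁿ`. -/
def nonTransverse (n m r : ℕ) (A : Set (EuclideanSpace ℝ (Fin m))) : Set (CrBall n m r) :=
  {f | ¬ IsTransverseOnBall f A}

/-! ### Small sets in Banach spaces -/

/-- `A` is Aronszajn null: for each sequence `e` that generates a dense linear subspace, `A` is
covered by Borel sets `S k`, where the intersection of `S k` with each line directed by `e k` is
Lebesgue null. -/
def IsAronszajnNull {F : Type*} [NormedAddCommGroup F] [NormedSpace ℝ F] (A : Set F) : Prop :=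
  ∀ e : ℕ → F, Dense (Submodule.span ℝ (range e) : Set F) →
    ∃ S : ℕ → Set F, (∀ k, MeasurableSet[borel F] (S k)) ∧ A ⊆ ⋃ k, S k ∧
      ∀ (f : F) (k : ℕ), volume {x : ℝ | f + x • e k ∈ S k} = 0

/-- `A` is Haar null: there is a Borel probability measure `μ` for which all translates of `A` are
null (i.e. contained in a Borel set of measure zero). -/
def IsHaarNull {F : Type*} [NormedAddCommGroup F] (A : Set F) : Prop :=
  ∃ μ : @Measure F (borel F), @IsProbabilityMeasure F (borel F) μ ∧
    ∀ f : F, μ ((fun a => a + f) '' A) = 0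

/-- `A` is a Lipschitz graph of codimension `d`: for some splitting `F = E ⊕ G` as a topological
direct sum with `dim G = d`, it is contained in the graph of a Lipschitz map `E → G`. -/
def IsLipschitzGraph {F : Type*} [NormedAddCommGroup F] [NormedSpace ℝ F] (d : ℕ) (A : Set F) :
    Prop :=
  ∃ E G : Submodule ℝ F, Submodule.IsTopCompl E G ∧ FiniteDimensional ℝ G ∧
    Module.finrank ℝ G = d ∧
    ∃ (K : NNReal) (g : E → G), LipschitzWith K g ∧ A ⊆ range fun x : E => (x : F) + (g x : F)

/-- `S` is the image of a Lipschitz graph of codimension `d + i` by a `C¹` map defined on an open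
subset of a separable Banach space and Fredholm of index `i`. -/
def IsFredholmImage.{u} {F : Type u} [NormedAddCommGroup F] [NormedSpace ℝ F] (d : ℕ) (S : Set F) :
    Prop :=
  ∃ (X : Type u) (_ : NormedAddCommGroup X) (_ : NormedSpace ℝ X) (_ : CompleteSpace X)
    (_ : TopologicalSpace.SeparableSpace X) (U : Set X) (φ : X → F) (i : ℤ) (k : ℕ) (B : Set X),
    IsOpen U ∧ ContDiffOn ℝ 1 φ U ∧
      (∀ x ∈ U, (fderiv ℝ φ x).IsFredholm ∧ (fderiv ℝ φ x : X →ₗ[ℝ] F).index = i) ∧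
      B ⊆ U ∧ (k : ℤ) = d + i ∧ IsLipschitzGraph k B ∧ S = φ '' B

/-- `A` is rectifiable of codimension `d`: it is a countable union of Fredholm images of Lipschitz
graphs as above. -/
def IsRectifiableOfCodim {F : Type*} [NormedAddCommGroup F] [NormedSpace ℝ F] (d : ℕ) (A : Set F) :
    Prop :=
  ∃ S : ℕ → Set F, (∀ j, IsFredholmImage d (S j)) ∧ A = ⋃ j, S j

end

/-! In a chart where `A = {g = 0}`, with `g` a submersion to `ℝᶜ`, the map `f` fails to be
transverse at `x` exactly when `g (f x) = 0` and `d(g ∘ f)_x` is not onto. Countably many charts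
suffice, so `NA` is a countable union of projections to `F = C^r` of zero sets of equations `Θ(f, p)
= 0`, with values in `Y` and a finite-dimensional unknown `p ∈ P`.

If `n ≤ c`, take `Θ(f, x) = g (f x)`: there are no more unknowns than equations, and the critical
zeros are those where `∂Θ/∂x` is not onto. Otherwise `r ≥ n - c + 1` forces `r ≥ 2`, and a covector
`λ`, normalized by `λ u = 1`, is added to the unknowns, together with the equation `λ ∘ d(g ∘ f)_x =
0`: `c + n` equations in `n + c - 1` unknowns, so that `∂Θ/∂p` is never onto.

In both cases `∂Θ/∂f` is onto, already along any space of perturbations that realizes all `1`-jets,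
such as the affine maps or any dense subspace. On a finite-dimensional slice of `F` in such
directions, the zeros are locally the graph of a Lipschitz map from a subset of `P` to `Y`, whose
derivative is not onto because `∂Θ/∂p` is not. As `dim P ≤ dim Y`, its image is null
(`HasStrictFDerivAt.exists_isNullAlong`). Closedness of the local projections then gives meagerness,
and Fubini gives Haar and Aronszajn nullity.

When `r ≥ 2`, the zero set is also locally a Lipschitz graph of codimension `c + n` in `F × P`
(`HasStrictFDerivAt.exists_isLipschitzGraph`), and the projection to `F` is Fredholm of index `n + c
- 1`: this is rectifiability of codimension `1`. -/

noncomputable section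

set_option linter.unusedSectionVars false

/-! ### The Banach space `C^r`: completeness, separability, jets. -/

section CrBasics

variable {V W : Type} [NormedAddCommGroup V] [NormedSpace ℝ V] [ProperSpace V]
  [NormedAddCommGroup W] [NormedSpace ℝ W] {r : ℕ}

open Classical in
/-- The formal Taylor series carried by a family `(u₀, …, u_r)`. -/
def JetFamily.series (u : JetFamily V W r) (x : V) : FormalMultilinearSeries ℝ V W := fun k =>
  if h : x ∈ Metric.closedBall (0 : V) 1 ∧ k < r + 1 then u.comp ⟨k, h.2⟩ ⟨x, h.1⟩ else 0

theorem JetFamily.norm_comp_le (u : JetFamily V W r) (k : Fin (r + 1)) : ‖u.comp k‖ ≤ ‖u‖ :=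
  PiLp.norm_apply_le (p := 1) (β := fun k : Fin (r + 1) =>
    C(Metric.closedBall (0 : V) 1, ContinuousMultilinearMap ℝ (fun _ : Fin (k : ℕ) => V) W)) u k

theorem JetFamily.series_sub (u v : JetFamily V W r) (x : V) (k : ℕ) :
    (u - v).series x k = u.series x k - v.series x k := by
  by_cases h : x ∈ Metric.closedBall (0 : V) 1 ∧ k < r + 1
  · simp only [JetFamily.series, dif_pos h]; rfl
  · simp only [JetFamily.series, dif_neg h, sub_zero]

theorem JetFamily.norm_series_le (u : JetFamily V W r) (x : V) (k : ℕ) :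
    ‖u.series x k‖ ≤ ‖u‖ := by
  by_cases h : x ∈ Metric.closedBall (0 : V) 1 ∧ k < r + 1
  · simp only [JetFamily.series, dif_pos h]
    exact ((u.comp ⟨k, h.2⟩).norm_coe_le_norm ⟨x, h.1⟩).trans (u.norm_comp_le _)
  · simp only [JetFamily.series, dif_neg h, norm_zero, norm_nonneg]

theorem JetFamily.series_eq (u : JetFamily V W r) {x : V} (hx : x ∈ Metric.closedBall (0 : V) 1)
    {k : ℕ} (hk : k < r + 1) : u.series x k = u.comp ⟨k, hk⟩ ⟨x, hx⟩ := by
  simp only [JetFamily.series, dif_pos (show x ∈ Metric.closedBall (0 : V) 1 ∧ k < r + 1 from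
    ⟨hx, hk⟩)]

theorem JetFamily.toMap_eq_series (u : JetFamily V W r) {x : V}
    (hx : x ∈ Metric.closedBall (0 : V) 1) : u.toMap x = (u.series x 0).curry0 := by
  rw [u.series_eq hx (Nat.succ_pos r)]
  simp only [JetFamily.toMap, dif_pos hx]
  rfl

theorem JetFamily.continuousOn_series (u : JetFamily V W r) (k : ℕ) :
    ContinuousOn (fun x => u.series x k) (Metric.closedBall 0 1) := by
  rw [continuousOn_iff_continuous_domRestrict]
  by_cases hk : k < r + 1
  · refine (u.comp ⟨k, hk⟩).continuous.congr fun x => ?_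
    rw [domRestrict_apply, u.series_eq x.2 hk]
  · refine (continuous_const (y := 0)).congr fun x => ?_
    simp [JetFamily.series, hk]

/-- A Taylor series relates consecutive orders by a single derivative, a form that passes to uniform
limits order by order, as needed for closedness. -/
theorem JetFamily.isCr_iff (u : JetFamily V W r) :
    u.IsCr ↔ HasFTaylorSeriesUpToOn r u.toMap u.series (Metric.ball 0 1) := by
  have ho : IsOpen (Metric.ball (0 : V) 1) := Metric.isOpen_ball
  constructor
  · rintro ⟨h, h'⟩
    refine (h.ftaylorSeriesWithin ho.uniqueDiffOn).congr_series fun k hk x hx => ?_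
    have hk' : k < r + 1 := Nat.lt_succ_of_le (by exact_mod_cast hk)
    show iteratedFDerivWithin ℝ k u.toMap _ x = u.series x k
    rw [u.series_eq (Metric.ball_subset_closedBall hx) hk', h' _ _ hx]
    exact iteratedFDerivWithin_of_isOpen k ho hx
  · intro h
    refine ⟨h.contDiffOn, fun k x hx => ?_⟩
    have hk : ((k : ℕ) : ℕ∞ω) ≤ (r : ℕ∞ω) := by exact_mod_cast Nat.lt_succ_iff.mp k.2
    rw [← iteratedFDerivWithin_of_isOpen k ho hx,
      ← h.eq_iteratedFDerivWithin_of_uniqueDiffOn hk ho.uniqueDiffOn hx, u.series_eq x.2 k.2]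

theorem isClosed_crSubmodule : IsClosed (crSubmodule V W r : Set (JetFamily V W r)) := by
  refine IsSeqClosed.isClosed fun u v hu huv => ?_
  have ho : IsOpen (Metric.ball (0 : V) 1) := Metric.isOpen_ball
  have hlim : ∀ k, TendstoUniformlyOn (fun j x => (u j).series x k) (fun x => v.series x k) atTop
      (Metric.ball 0 1) := by
    intro k
    rw [Metric.tendstoUniformlyOn_iff]
    intro ε hε
    filter_upwards [Metric.tendsto_nhds.1 huv ε hε] with j hj x _
    rw [dist_eq_norm, ← JetFamily.series_sub]
    refine (JetFamily.norm_series_le _ _ _).trans_lt ?_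
    rwa [← dist_eq_norm, dist_comm]
  refine (JetFamily.isCr_iff v).2 ⟨fun x hx => ?_, fun k hk x hx => ?_, fun k _ => ?_⟩
  · rw [v.toMap_eq_series (Metric.ball_subset_closedBall hx)]
  · refine HasFDerivAt.hasFDerivWithinAt ?_
    refine hasFDerivAt_of_tendstoUniformlyOn (l := atTop) (f := fun j x => (u j).series x k)
      (f' := fun j x => ((u j).series x (k + 1)).curryLeft)
      (g' := fun x => (v.series x (k + 1)).curryLeft) ho ?_ ?_ ?_ hx
    · exact (continuousMultilinearCurryLeftEquiv ℝ (fun _ : Fin (k + 1) => V)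
        W).isometry.uniformContinuous.comp_tendstoUniformlyOn (hlim (k + 1))
    · intro j y hy
      exact (((JetFamily.isCr_iff _).1 (hu j)).fderivWithin k hk y hy).hasFDerivAt (ho.mem_nhds hy)
    · exact fun y hy => (hlim k).tendsto_at hy
  · exact (v.continuousOn_series k).mono Metric.ball_subset_closedBall

instance [CompleteSpace W] : CompleteSpace (JetFamily V W r) :=
  inferInstanceAs (CompleteSpace (PiLp 1 fun k : Fin (r + 1) =>
    C(Metric.closedBall (0 : V) 1, ContinuousMultilinearMap ℝ (fun _ : Fin (k : ℕ) => V) W)))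

instance [CompleteSpace W] : CompleteSpace (CrSpace V W r) :=
  (isClosed_crSubmodule (V := V) (W := W) (r := r)).completeSpace_coe

instance ContinuousMultilinearMap.finiteDimensional [FiniteDimensional ℝ V]
    [FiniteDimensional ℝ W] (k : ℕ) :
    FiniteDimensional ℝ (ContinuousMultilinearMap ℝ (fun _ : Fin k => V) W) :=
  Module.Finite.of_injective
    (ContinuousMultilinearMap.toMultilinearMapLinear :
      ContinuousMultilinearMap ℝ (fun _ : Fin k => V) W →ₗ[ℝ] _)
    ContinuousMultilinearMap.toMultilinearMap_injective

instance [FiniteDimensional ℝ V] [FiniteDimensional ℝ W] :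
    SecondCountableTopology (JetFamily V W r) :=
  have : ∀ k : Fin (r + 1), SecondCountableTopology
      (ContinuousMultilinearMap ℝ (fun _ : Fin (k : ℕ) => V) W) := fun k =>
    have : ProperSpace (ContinuousMultilinearMap ℝ (fun _ : Fin (k : ℕ) => V) W) :=
      FiniteDimensional.proper_real _
    inferInstance
  have : ∀ k : Fin (r + 1), SecondCountableTopology
    C(Metric.closedBall (0 : V) 1, ContinuousMultilinearMap ℝ (fun _ : Fin (k : ℕ) => V) W) :=
    fun _ => inferInstance
  inferInstanceAs (SecondCountableTopology (PiLp 1 fun k : Fin (r + 1) =>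
    C(Metric.closedBall (0 : V) 1, ContinuousMultilinearMap ℝ (fun _ : Fin (k : ℕ) => V) W)))

instance [FiniteDimensional ℝ V] [FiniteDimensional ℝ W] :
    SecondCountableTopology (CrSpace V W r) :=
  inferInstanceAs (SecondCountableTopology (crSubmodule V W r))

namespace CrSpace

theorem toMap_add (f g : CrSpace V W r) : (f + g).toMap = f.toMap + g.toMap :=
  JetFamily.toMap_add _ _

theorem toMap_smul (a : ℝ) (f : CrSpace V W r) : (a • f).toMap = a • f.toMap :=
  JetFamily.toMap_smul _ _

theorem toMap_sub (f g : CrSpace V W r) : (f - g).toMap = f.toMap - g.toMap := by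
  rw [sub_eq_add_neg, ← neg_one_smul ℝ g, toMap_add, toMap_smul, neg_one_smul, sub_eq_add_neg]

theorem contDiffAt (f : CrSpace V W r) {x : V} (hx : x ∈ Metric.ball 0 1) :
    ContDiffAt ℝ r f.toMap x :=
  f.2.1.contDiffAt (Metric.isOpen_ball.mem_nhds hx)

theorem norm_iteratedFDeriv_le (f : CrSpace V W r) {k : ℕ} (hk : k ≤ r) {x : V}
    (hx : x ∈ Metric.ball 0 1) : ‖iteratedFDeriv ℝ k f.toMap x‖ ≤ ‖f‖ := by
  have h := f.2.2 ⟨k, Nat.lt_succ_of_le hk⟩ ⟨x, Metric.ball_subset_closedBall hx⟩ hx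
  simp only [CrSpace.toMap]
  rw [← h]
  exact ((JetFamily.comp f.1 _).norm_coe_le_norm _).trans (JetFamily.norm_comp_le _ _)

theorem norm_toMap_le (f : CrSpace V W r) {x : V} (hx : x ∈ Metric.ball 0 1) :
    ‖f.toMap x‖ ≤ ‖f‖ := by
  simpa using f.norm_iteratedFDeriv_le (Nat.zero_le r) hx

theorem norm_fderiv_le (f : CrSpace V W r) (hr : 1 ≤ r) {x : V} (hx : x ∈ Metric.ball 0 1) :
    ‖fderiv ℝ f.toMap x‖ ≤ ‖f‖ := by
  rw [← norm_iteratedFDeriv_one]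
  exact f.norm_iteratedFDeriv_le hr hx

theorem norm_fderiv_fderiv_le (f : CrSpace V W r) (hr : 2 ≤ r) {x : V}
    (hx : x ∈ Metric.ball 0 1) : ‖fderiv ℝ (fderiv ℝ f.toMap) x‖ ≤ ‖f‖ := by
  rw [← norm_iteratedFDeriv_one, norm_iteratedFDeriv_fderiv]
  exact f.norm_iteratedFDeriv_le hr hx

theorem differentiableAt (f : CrSpace V W r) (hr : 1 ≤ r) {x : V} (hx : x ∈ Metric.ball 0 1) :
    DifferentiableAt ℝ f.toMap x :=
  (f.contDiffAt hx).differentiableAt (by exact_mod_cast (Nat.one_le_iff_ne_zero.1 hr))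

theorem contDiffAt_fderiv (f : CrSpace V W r) {k : ℕ} (hr : k + 1 ≤ r) {x : V}
    (hx : x ∈ Metric.ball 0 1) : ContDiffAt ℝ k (fderiv ℝ f.toMap) x :=
  (f.contDiffAt hx).fderiv_right (by exact_mod_cast hr)

theorem fderiv_add (f g : CrSpace V W r) (hr : 1 ≤ r) {x : V} (hx : x ∈ Metric.ball 0 1) :
    fderiv ℝ (f + g).toMap x = fderiv ℝ f.toMap x + fderiv ℝ g.toMap x := by
  rw [toMap_add]
  exact _root_.fderiv_add (f.differentiableAt hr hx) (g.differentiableAt hr hx)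

theorem fderiv_sub (f g : CrSpace V W r) (hr : 1 ≤ r) {x : V} (hx : x ∈ Metric.ball 0 1) :
    fderiv ℝ (f - g).toMap x = fderiv ℝ f.toMap x - fderiv ℝ g.toMap x := by
  rw [toMap_sub]
  exact _root_.fderiv_sub (f.differentiableAt hr hx) (g.differentiableAt hr hx)

theorem fderiv_smul (a : ℝ) (f : CrSpace V W r) (hr : 1 ≤ r) {x : V}
    (hx : x ∈ Metric.ball 0 1) : fderiv ℝ (a • f).toMap x = a • fderiv ℝ f.toMap x := by
  rw [toMap_smul]
  exact _root_.fderiv_const_smul (f.differentiableAt hr hx) a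

/-- The `1`-jet at a point `x` of the open ball, as a continuous linear map. -/
def jetL (hr : 1 ≤ r) {x : V} (hx : x ∈ Metric.ball 0 1) : CrSpace V W r →L[ℝ] W × (V →L[ℝ] W) :=
  LinearMap.mkContinuous
    { toFun := fun f => (f.toMap x, fderiv ℝ f.toMap x)
      map_add' := fun f g => by rw [fderiv_add f g hr hx, toMap_add]; rfl
      map_smul' := fun a f => by rw [fderiv_smul a f hr hx, toMap_smul]; rfl }
    1 fun f => by
      rw [one_mul]
      exact max_le (f.norm_toMap_le hx) (f.norm_fderiv_le hr hx)

@[simp]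
theorem jetL_apply (hr : 1 ≤ r) {x : V} (hx : x ∈ Metric.ball 0 1) (f : CrSpace V W r) :
    jetL hr hx f = (f.toMap x, fderiv ℝ f.toMap x) := rfl

/-- The restriction to the ball of a map that is `C^r` everywhere. -/
def ofContDiff (φ : V → W) (hφ : ContDiff ℝ r φ) : CrSpace V W r :=
  ⟨WithLp.toLp 1 fun k => ⟨fun x => iteratedFDeriv ℝ (k : ℕ) φ x,
      (hφ.continuous_iteratedFDeriv (by exact_mod_cast Nat.lt_succ_iff.mp k.2)).comp
        continuous_subtype_val⟩, by
    set u : JetFamily V W r := WithLp.toLp 1 fun k => ⟨fun x => iteratedFDeriv ℝ (k : ℕ) φ x,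
      (hφ.continuous_iteratedFDeriv (by exact_mod_cast Nat.lt_succ_iff.mp k.2)).comp
        continuous_subtype_val⟩ with hu
    have h : EqOn u.toMap φ (Metric.ball 0 1) := fun x hx => by
      simp only [JetFamily.toMap, dif_pos (Metric.ball_subset_closedBall hx)]
      rfl
    refine ⟨hφ.contDiffOn.congr h, fun k x hx => ?_⟩
    rw [((h.eventuallyEq_of_mem (Metric.isOpen_ball.mem_nhds hx)).iteratedFDeriv ℝ k).eq_of_nhds]
    rfl⟩

theorem toMap_ofContDiff (φ : V → W) (hφ : ContDiff ℝ r φ) :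
    EqOn (ofContDiff φ hφ).toMap φ (Metric.ball 0 1) := fun x hx => by
  simp only [CrSpace.toMap, JetFamily.toMap, dif_pos (Metric.ball_subset_closedBall hx)]
  rfl

theorem fderiv_toMap_ofContDiff (φ : V → W) (hφ : ContDiff ℝ r φ) {x : V}
    (hx : x ∈ Metric.ball 0 1) : fderiv ℝ (ofContDiff φ hφ).toMap x = fderiv ℝ φ x :=
  ((toMap_ofContDiff φ hφ).eventuallyEq_of_mem (Metric.isOpen_ball.mem_nhds hx)).fderiv_eq

theorem ext_comp {f g : CrSpace V W r}
    (h : ∀ k x, JetFamily.comp f.1 k x = JetFamily.comp g.1 k x) : f = g :=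
  Subtype.ext (WithLp.ofLp_injective 1 (funext fun k => ContinuousMap.ext (h k)))

/-- The affine maps `x ↦ a + B x`, as elements of `C^r`. -/
def affine : (W × (V →L[ℝ] W)) →ₗ[ℝ] CrSpace V W r where
  toFun p := ofContDiff (fun x => p.1 + p.2 x) (contDiff_const.add p.2.contDiff)
  map_add' p q := by
    refine ext_comp fun k x => ?_
    show iteratedFDeriv ℝ (k : ℕ) (fun y : V => (p + q).1 + (p + q).2 y) x =
      iteratedFDeriv ℝ (k : ℕ) (fun y : V => p.1 + p.2 y) x +
        iteratedFDeriv ℝ (k : ℕ) (fun y : V => q.1 + q.2 y) x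
    rw [← iteratedFDeriv_add_apply (contDiff_const.add p.2.contDiff).contDiffAt
      (contDiff_const.add q.2.contDiff).contDiffAt]
    congr 1
    funext y
    simp only [Prod.fst_add, Prod.snd_add, _root_.add_apply, Pi.add_apply]
    abel
  map_smul' a p := by
    refine ext_comp fun k x => ?_
    show iteratedFDeriv ℝ (k : ℕ) (fun y : V => (a • p).1 + (a • p).2 y) x =
      a • iteratedFDeriv ℝ (k : ℕ) (fun y : V => p.1 + p.2 y) x
    rw [← iteratedFDeriv_const_smul_apply (contDiff_const.add p.2.contDiff).contDiffAt]
    congr 1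
    funext y
    simp

theorem affine_jet (hr : 1 ≤ r) (a : W) (B : V →L[ℝ] W) {x : V} (hx : x ∈ Metric.ball 0 1) :
    jetL hr hx (affine (r := r) (a, B)) = (a + B x, B) := by
  have h : fderiv ℝ (fun y => a + B y) x = B := by
    rw [fderiv_const_add]; exact B.fderiv
  have hB : ContDiff ℝ r fun y => a + B y := contDiff_const.add B.contDiff
  exact Prod.ext (toMap_ofContDiff _ hB hx) ((fderiv_toMap_ofContDiff _ hB hx).trans h)

/-- A linear subspace of `C^r` is jet-rich if its elements have arbitrary `1`-jets at each point
of the open ball. -/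
def JetRich (hr : 1 ≤ r) (D : Submodule ℝ (CrSpace V W r)) : Prop :=
  ∀ (x : V) (hx : x ∈ Metric.ball 0 1) (j : W × (V →L[ℝ] W)), ∃ h ∈ D, jetL hr hx h = j

theorem jetRich_range_affine (hr : 1 ≤ r) :
    JetRich hr (LinearMap.range (affine (V := V) (W := W) (r := r))) := by
  rintro x hx ⟨a, B⟩
  refine ⟨_, ⟨(a - B x, B), rfl⟩, ?_⟩
  rw [affine_jet, sub_add_cancel]

/-- The image in the finite-dimensional jet space is a dense subspace, hence everything. This is how
the dense span in the Aronszajn condition enters. -/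
theorem jetRich_of_dense [FiniteDimensional ℝ V] [FiniteDimensional ℝ W] (hr : 1 ≤ r)
    (D : Submodule ℝ (CrSpace V W r)) (hD : Dense (D : Set (CrSpace V W r))) : JetRich hr D := by
  intro x hx j
  have hs : Function.Surjective (jetL (V := V) (W := W) hr hx) := fun j => by
    obtain ⟨h, -, e⟩ := jetRich_range_affine hr x hx j
    exact ⟨h, e⟩
  have hd : Dense (D.map (jetL (V := V) (W := W) hr hx).toLinearMap : Set (W × (V →L[ℝ] W))) := by
    rw [Submodule.map_coe]
    exact hs.denseRange.dense_image (jetL hr hx).continuous hD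
  have hc := (D.map (jetL (V := V) (W := W) hr hx).toLinearMap).closed_of_finiteDimensional
  have : j ∈ (D.map (jetL (V := V) (W := W) hr hx).toLinearMap : Set (W × (V →L[ℝ] W))) := by
    rw [← hc.closure_eq, hd.closure_eq]; trivial
  obtain ⟨h, hh, e⟩ := this
  exact ⟨h, hh, e⟩

end CrSpace

end CrBasics

/-! ### Fubini arguments: from null finite-dimensional slices to meager, Haar null and Aronszajn
null sets. -/

section NullSets

variable {F : Type*} [NormedAddCommGroup F] [NormedSpace ℝ F]

/-- If the slices of a closed set by all translates of a finite-dimensional family of directions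
are null, so are its slices by any larger finite-dimensional family. -/
theorem measure_slice_eq_zero_of_factor {E Y : Type*} [NormedAddCommGroup E] [NormedSpace ℝ E]
    [FiniteDimensional ℝ E] [MeasurableSpace E] [BorelSpace E]
    [NormedAddCommGroup Y] [NormedSpace ℝ Y] [FiniteDimensional ℝ Y]
    [MeasurableSpace Y] [BorelSpace Y] (μ : Measure E) [μ.IsAddHaarMeasure]
    (ν : Measure Y) [ν.IsAddHaarMeasure] (M : E →ₗ[ℝ] F) (L : Y →ₗ[ℝ] E) {T : Set F}
    (hT : IsClosed T) (h : ∀ f, ν {y | f + M (L y) ∈ T} = 0) (f : F) :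
    μ {u | f + M u ∈ T} = 0 := by
  have : ProperSpace E := FiniteDimensional.proper_real E
  have : ProperSpace Y := FiniteDimensional.proper_real Y
  have hM : Continuous M := M.continuous_of_finiteDimensional
  have hL : Continuous L := L.continuous_of_finiteDimensional
  have hS : MeasurableSet {q : E × Y | f + M (q.1 + L q.2) ∈ T} :=
    (hT.preimage (by fun_prop :
      Continuous fun q : E × Y => f + M (q.1 + L q.2))).measurableSet
  -- Fubini in both orders: all slices at fixed `u` are null by `h`, so the slice at some fixed `y`
  -- is null, and it is a translate by `L y` of the set in question.
  have h0 : (μ.prod ν) {q : E × Y | f + M (q.1 + L q.2) ∈ T} = 0 := by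
    rw [Measure.measure_prod_null hS]
    refine Eventually.of_forall fun u => ?_
    simpa [map_add, add_assoc] using h (f + M u)
  rw [Measure.prod_apply_symm hS, lintegral_eq_zero_iff (measurable_measure_prodMk_right hS)] at h0
  obtain ⟨y, hy⟩ := h0.exists
  have hy' : μ ((fun u => u + L y) ⁻¹' {u | f + M u ∈ T}) = 0 := hy
  rwa [measure_preimage_add_right] at hy'

/-- `T` is closed, and for some finite-dimensional family of directions in `D`, all slices of `T`
are Lebesgue null. -/
def IsNullAlong (D : Submodule ℝ F) (T : Set F) : Prop :=
  IsClosed T ∧ ∃ (p : ℕ) (L : (Fin p → ℝ) →ₗ[ℝ] F), (∀ y, L y ∈ D) ∧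
    ∀ f, volume {y | f + L y ∈ T} = 0

theorem IsNullAlong.of_finiteDimensional {D : Submodule ℝ F} {T : Set F} {Y : Type*}
    [NormedAddCommGroup Y] [NormedSpace ℝ Y] [FiniteDimensional ℝ Y] [MeasurableSpace Y]
    [BorelSpace Y] (ν : Measure Y) [ν.IsAddHaarMeasure] (hT : IsClosed T) (L : Y →ₗ[ℝ] F)
    (hL : ∀ y, L y ∈ D) (h : ∀ f, ν {y | f + L y ∈ T} = 0) : IsNullAlong D T := by
  have e : Y ≃ₗ[ℝ] (Fin (Module.finrank ℝ Y) → ℝ) := (Module.finBasis ℝ Y).equivFun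
  refine ⟨hT, _, L ∘ₗ e.symm.toLinearMap, fun y => hL _, ?_⟩
  refine measure_slice_eq_zero_of_factor volume ν _ e.toLinearMap hT fun f => ?_
  simpa using h f

theorem IsNullAlong.measure_slice_range_eq_zero {E : Type*} [NormedAddCommGroup E]
    [NormedSpace ℝ E] [FiniteDimensional ℝ E] [MeasurableSpace E] [BorelSpace E]
    (μ : Measure E) [μ.IsAddHaarMeasure] {M : E →ₗ[ℝ] F} {T : Set F}
    (hT : IsNullAlong (LinearMap.range M) T) (f : F) : μ {u | f + M u ∈ T} = 0 := by
  obtain ⟨hT, p, L, hL, h⟩ := hT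
  choose g hg using hL
  let b := Pi.basisFun ℝ (Fin p)
  have hb : M ∘ₗ b.constr ℝ (fun i => g (b i)) = L := b.ext fun i => by simp [hg]
  refine measure_slice_eq_zero_of_factor μ volume M (b.constr ℝ fun i => g (b i)) hT
    (fun f => ?_) f
  rw [← hb] at h
  exact h f

theorem IsNullAlong.interior_eq_empty {D : Submodule ℝ F} {T : Set F} (hT : IsNullAlong D T) :
    interior T = ∅ := by
  obtain ⟨-, p, L, -, h⟩ := hT
  refine eq_empty_of_forall_notMem fun f hf => ?_
  have hL : Continuous fun y => f + L y :=
    continuous_const.add L.continuous_of_finiteDimensional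
  have ho : IsOpen {y | f + L y ∈ interior T} := isOpen_interior.preimage hL
  refine (ho.measure_pos volume ⟨0, by simpa using hf⟩).ne' ?_
  exact measure_mono_null (fun y (hy : f + L y ∈ interior T) =>
    (interior_subset hy : f + L y ∈ T)) (h f)

theorem isMeagre_of_subset_iUnion {D : Submodule ℝ F} {A : Set F} {T : ℕ → Set F}
    (hA : A ⊆ ⋃ j, T j) (hT : ∀ j, IsNullAlong D (T j)) : IsMeagre A := by
  refine IsMeagre.mono hA (isMeagre_iUnion fun j => ?_)
  refine IsNowhereDense.isMeagre ?_
  rw [(hT j).1.isNowhereDense_iff]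
  exact (hT j).interior_eq_empty

/-- The test measure is normalized Lebesgue measure on the unit ball of `E`, pushed forward by `M`;
a single finite-dimensional family of directions serves all the `T j`. -/
theorem isHaarNull_of_subset_iUnion {E : Type*} [NormedAddCommGroup E]
    [NormedSpace ℝ E] [FiniteDimensional ℝ E] (M : E →ₗ[ℝ] F) {A : Set F} {T : ℕ → Set F}
    (hA : A ⊆ ⋃ j, T j) (hT : ∀ j, IsNullAlong (LinearMap.range M) (T j)) : IsHaarNull A := by
  borelize E
  borelize F
  have : ProperSpace E := FiniteDimensional.proper_real E
  have hM : Continuous M := M.continuous_of_finiteDimensional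
  let μ : Measure E := ProbabilityTheory.cond Measure.addHaar (Metric.ball (0 : E) 1)
  have hμ : IsProbabilityMeasure μ :=
    ProbabilityTheory.cond_isProbabilityMeasure_of_finite
      (Metric.measure_ball_pos _ _ one_pos).ne' measure_ball_lt_top.ne
  refine ⟨μ.map M, Measure.isProbabilityMeasure_map hM.aemeasurable, fun f => ?_⟩
  refine measure_mono_null (image_mono hA) ?_
  rw [image_iUnion]
  refine measure_iUnion_null fun j => ?_
  have hc : IsClosed ((fun a => a + f) '' T j) :=
    (Homeomorph.addRight f).isClosedMap _ (hT j).1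
  rw [Measure.map_apply hM.measurable hc.measurableSet]
  refine ProbabilityTheory.cond_absolutelyContinuous ?_
  convert (hT j).measure_slice_range_eq_zero Measure.addHaar (-f) using 2
  ext u
  simp only [mem_preimage, mem_image, mem_ofPred_eq]
  exact ⟨by rintro ⟨a, ha, e⟩; rwa [← e, neg_add_cancel_comm_assoc], fun h => ⟨_, h, by abel⟩⟩

/-- A Borel set whose slices by the translates of the span of `e 0, …, e (N - 1)` are null is
covered by Borel sets that are null in the directions `e k`. -/
theorem exists_borel_cover_of_slices_null [MeasurableSpace F] [BorelSpace F] (e : ℕ → F) (N : ℕ) :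
    ∀ T : Set F, MeasurableSet T →
      (∀ f, volume {u : Fin N → ℝ | f + ∑ i, u i • e i ∈ T} = 0) →
      ∃ S : ℕ → Set F, (∀ k, MeasurableSet (S k)) ∧ T ⊆ ⋃ k, S k ∧
        ∀ (f : F) (k : ℕ), volume {x : ℝ | f + x • e k ∈ S k} = 0 := by
  induction N with
  | zero =>
    intro T _ h
    refine ⟨fun _ => ∅, fun _ => MeasurableSet.empty, fun f hf => ?_, by simp⟩
    -- The space `Fin 0 → ℝ` is a point of positive measure, so `T` has to be empty.
    have := h f
    have hv : (volume : Measure (Fin 0 → ℝ)) univ = 0 := by simpa [hf] using this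
    exact absurd hv (isOpen_univ.measure_pos volume univ_nonempty).ne'
  | succ N ih =>
    intro T hT h
    -- `T` is split by whether its line through `f` in direction `e N` is null. The part with `p =
    -- 0` is assigned to `e N`; the rest has null slices in the first `N` directions by Fubini, and
    -- induction applies.
    let p : F → ENNReal := fun f => volume {x : ℝ | f + x • e N ∈ T}
    have hp : Measurable p := by
      have : MeasurableSet {q : F × ℝ | q.1 + q.2 • e N ∈ T} :=
        (by fun_prop : Continuous fun q : F × ℝ => q.1 + q.2 • e N).measurable hT
      exact measurable_measure_prodMk_left this
    have hp0 : MeasurableSet {f | p f = 0} := hp (measurableSet_singleton 0)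
    obtain ⟨S, hS, hTS, hnull⟩ := ih (T ∩ {f | p f = 0}ᶜ) (hT.inter hp0.compl) fun f => by
      have hmeas : MeasurableSet {q : ℝ × (Fin N → ℝ) | f + ∑ i, q.2 i • e i + q.1 • e N ∈ T} :=
        (by fun_prop : Continuous fun q : ℝ × (Fin N → ℝ) =>
          f + ∑ i, q.2 i • e i + q.1 • e N).measurable hT
      have h0 : (volume : Measure (ℝ × (Fin N → ℝ)))
          {q | f + ∑ i, q.2 i • e i + q.1 • e N ∈ T} = 0 := by
        rw [← (volume_preserving_piFinSuccAbove (fun _ : Fin (N + 1) => ℝ)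
          (Fin.last N)).measure_preimage hmeas.nullMeasurableSet, ← h f]
        congr 1
        ext u
        simp [MeasurableEquiv.piFinSuccAbove, Fin.sum_univ_castSucc, Fin.init, add_assoc]
      rw [Measure.volume_eq_prod, Measure.prod_apply_symm hmeas,
        lintegral_eq_zero_iff (measurable_measure_prodMk_right hmeas)] at h0
      refine measure_mono_null (fun u hu => ?_) h0
      exact hu.2
    refine ⟨fun k => S k ∪ {f | k = N ∧ f ∈ T ∩ {f | p f = 0}}, fun k => ?_, fun f hf => ?_,
      fun f k => ?_⟩
    · refine (hS k).union ?_
      by_cases hk : k = N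
      · have : {f | k = N ∧ f ∈ T ∩ {f | p f = 0}} = T ∩ {f | p f = 0} := by
          ext f; exact and_iff_right hk
        rw [this]
        exact hT.inter hp0
      · simp [hk]
    · by_cases h0 : p f = 0
      · exact mem_iUnion.2 ⟨N, Or.inr ⟨rfl, hf, h0⟩⟩
      · obtain ⟨k, hk⟩ := mem_iUnion.1 (hTS ⟨hf, h0⟩)
        exact mem_iUnion.2 ⟨k, Or.inl hk⟩
    · refine measure_union_null (hnull f k) ?_
      by_cases hk : ∃ x : ℝ, k = N ∧ f + x • e k ∈ T ∩ {f | p f = 0}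
      · obtain ⟨x, rfl, hx, hx0⟩ := hk
        -- By translation invariance `p` is constant along `e N`, so one point of the line with `p =
        -- 0` makes the whole line null.
        have hpf : p f = 0 := by
          have : (fun y => y + x) ⁻¹' {y : ℝ | f + y • e k ∈ T} =
              {y : ℝ | f + x • e k + y • e k ∈ T} := by
            ext y; simp only [mem_preimage, mem_ofPred_eq, add_smul]
            rw [add_comm (y • e k), add_assoc]
          rw [← hx0]
          show volume _ = volume _
          rw [← this, measure_preimage_add_right]
        exact measure_mono_null (fun y hy => hy.2.1) hpf
      · exact measure_mono_null (fun y hy => (hk ⟨y, hy⟩).elim) measure_empty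

/-- Finitely many vectors of the span involve finitely many of the `e k`, so the directions of `L`
can be enlarged to `e 0, …, e (N - 1)`. -/
theorem IsNullAlong.exists_borel_cover [MeasurableSpace F] [BorelSpace F] {e : ℕ → F} {T : Set F}
    (hT : IsNullAlong (Submodule.span ℝ (range e)) T) :
    ∃ S : ℕ → Set F, (∀ k, MeasurableSet (S k)) ∧ T ⊆ ⋃ k, S k ∧
      ∀ (f : F) (k : ℕ), volume {x : ℝ | f + x • e k ∈ S k} = 0 := by
  obtain ⟨hT, p, L, hL, h⟩ := hT
  choose c hc using fun i : Fin p =>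
    Finsupp.mem_span_range_iff_exists_finsupp.1 (hL (Pi.basisFun ℝ (Fin p) i))
  obtain ⟨N, hN⟩ : ∃ N : ℕ, ∀ i, (c i).support ⊆ Finset.range N := by
    refine ⟨(Finset.univ.biUnion fun i => (c i).support).sup id + 1, fun i k hk => ?_⟩
    rw [Finset.mem_range, Nat.lt_succ_iff]
    exact Finset.le_sup (f := id) (Finset.mem_biUnion.2 ⟨i, Finset.mem_univ i, hk⟩)
  let M : (Fin N → ℝ) →ₗ[ℝ] F := Fintype.linearCombination ℝ fun i : Fin N => e i
  let L' : (Fin p → ℝ) →ₗ[ℝ] (Fin N → ℝ) :=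
    (Pi.basisFun ℝ (Fin p)).constr ℝ fun i k => c i k
  have hML : M ∘ₗ L' = L := (Pi.basisFun ℝ (Fin p)).ext fun i => by
    rw [← hc i, LinearMap.comp_apply, Module.Basis.constr_basis,
      Finsupp.sum_of_support_subset _ (hN i) _ (by simp)]
    simp [M, Fintype.linearCombination_apply, Finset.sum_range]
  refine exists_borel_cover_of_slices_null e N T hT.measurableSet fun f => ?_
  exact measure_slice_eq_zero_of_factor volume volume M L' hT
    (fun f => by rw [← hML] at h; exact h f) f

theorem isAronszajnNull_of_subset_iUnion {A : Set F}
    (h : ∀ D : Submodule ℝ F, Dense (D : Set F) →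
      ∃ T : ℕ → Set F, A ⊆ ⋃ j, T j ∧ ∀ j, IsNullAlong D (T j)) : IsAronszajnNull A := by
  intro e he
  borelize F
  obtain ⟨T, hA, hT⟩ := h _ he
  choose S hS hTS hnull using fun j => (hT j).exists_borel_cover
  refine ⟨fun k => ⋃ j, S j k, fun k => MeasurableSet.iUnion fun j => hS j k, fun f hf => ?_,
    fun f k => ?_⟩
  · obtain ⟨j, hj⟩ := mem_iUnion.1 (hA hf)
    obtain ⟨k, hk⟩ := mem_iUnion.1 (hTS j hj)
    exact mem_iUnion.2 ⟨k, mem_iUnion.2 ⟨j, hk⟩⟩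
  · refine measure_mono_null (fun x hx => ?_) (measure_iUnion_null fun j => hnull j f k)
    simpa using hx

end NullSets

/-! ### Zero sets of strictly differentiable equations: Lipschitz graphs and null projections. -/

section StrictZeros

/-- Split `X = ker Θ' ⊕ range R` with `R` a right inverse of `Θ'`. Near `z₀` strict
differentiability gives `‖Θ' (z - z')‖ ≤ c ‖z - z'‖` for two zeros, a cone condition that bounds the
`range R` component of `z - z'` by the kernel component. No completeness is needed, since only
containment in a graph is claimed. -/
theorem HasStrictFDerivAt.exists_isLipschitzGraph {X Y : Type*} [NormedAddCommGroup X]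
    [NormedSpace ℝ X] [NormedAddCommGroup Y] [NormedSpace ℝ Y] [FiniteDimensional ℝ Y]
    {Θ : X → Y} {Θ' : X →L[ℝ] Y} {z₀ : X} (h : HasStrictFDerivAt Θ Θ' z₀)
    (hs : Function.Surjective Θ') :
    ∃ N ∈ 𝓝 z₀, ∀ B ⊆ N, (∀ z ∈ B, Θ z = 0) → IsLipschitzGraph (Module.finrank ℝ Y) B := by
  obtain ⟨R₀, hR₀⟩ := Θ'.toLinearMap.exists_rightInverse_of_surjective
    (LinearMap.range_eq_top.2 hs)
  let R : Y →L[ℝ] X := LinearMap.toContinuousLinearMap R₀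
  have hR : ∀ y, Θ' (R y) = y := fun y => LinearMap.congr_fun hR₀ y
  -- Chosen so that `‖R‖ c ≤ 1/2`, which lets half of `‖z - z'‖` be absorbed below; the `+ 1` covers
  -- `R = 0`.
  have hc : (0 : ℝ) < 1 / (2 * (‖R‖ + 1)) := by positivity
  obtain ⟨N, hN, hlin⟩ := h.approximates_deriv_on_nhds (c := ⟨_, hc.le⟩) (Or.inr hc)
  refine ⟨N, hN, fun B hBN hB => ?_⟩
  have hcone : ∀ z ∈ B, ∀ z' ∈ B, ‖R (Θ' z) - R (Θ' z')‖ ≤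
      ‖(z - R (Θ' z)) - (z' - R (Θ' z'))‖ := by
    intro z hz z' hz'
    have h1 := hlin _ (hBN hz) _ (hBN hz')
    rw [hB z hz, hB z' hz', sub_self, zero_sub, norm_neg] at h1
    have h2 : ‖R (Θ' z) - R (Θ' z')‖ ≤ ‖R‖ * ‖Θ' (z - z')‖ := by
      rw [← map_sub, ← map_sub]; exact R.le_opNorm _
    have h3 : ‖z - z'‖ ≤ ‖(z - R (Θ' z)) - (z' - R (Θ' z'))‖ + ‖R (Θ' z) - R (Θ' z')‖ := by
      refine le_trans (le_of_eq ?_) (norm_add_le _ _)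
      congr 1; abel
    have h4 : ‖R‖ * (1 / (2 * (‖R‖ + 1))) ≤ 1 / 2 := by
      rw [mul_one_div, div_le_div_iff₀ (by positivity) two_pos]
      linarith
    have h5 : ‖R (Θ' z) - R (Θ' z')‖ ≤ 1 / 2 * ‖z - z'‖ := by
      refine (h2.trans (mul_le_mul_of_nonneg_left h1 (norm_nonneg _))).trans ?_
      rw [← mul_assoc]
      exact mul_le_mul_of_nonneg_right h4 (norm_nonneg _)
    linarith
  let E : Submodule ℝ X := Θ'.ker
  let G : Submodule ℝ X := R.range
  have hinj : Function.Injective R := Function.LeftInverse.injective hR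
  have hG : Module.finrank ℝ G = Module.finrank ℝ Y := LinearMap.finrank_range_of_inj hinj
  let π : X → E := fun z => ⟨z - R (Θ' z), by
    show Θ' _ = 0
    rw [map_sub, hR, sub_self]⟩
  let γ : X → G := fun z => ⟨R (Θ' z), Θ' z, rfl⟩
  let ρ : E → X := Function.invFunOn π B
  have hρ : ∀ e ∈ π '' B, ρ e ∈ B ∧ π (ρ e) = e := fun e he =>
    ⟨Function.invFunOn_mem he, Function.invFunOn_eq he⟩
  have hlip : LipschitzOnWith 1 (fun e => γ (ρ e)) (π '' B) := by
    refine LipschitzOnWith.of_dist_le_mul fun e he e' he' => ?_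
    rw [NNReal.coe_one, one_mul]
    conv_rhs => rw [← (hρ e he).2, ← (hρ e' he').2]
    rw [dist_eq_norm, dist_eq_norm]
    exact hcone _ (hρ e he).1 _ (hρ e' he').1
  have : FiniteDimensional ℝ G := inferInstanceAs (FiniteDimensional ℝ (LinearMap.range _))
  -- The map is so far defined on `π '' B` only; finite dimension of `G` allows a Lipschitz
  -- extension to all of `E`.
  obtain ⟨g, hg, hgeq⟩ := hlip.extend_finite_dimension
  refine ⟨E, G, (R.isTopCompl_range_ker_of_leftInverse Θ' hR).symm, this, hG, _, g, hg,
    fun z hz => ⟨π z, ?_⟩⟩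
  have hz' : π z ∈ π '' B := ⟨z, hz, rfl⟩
  have hγ : γ (ρ (π z)) = γ z := by
    have h1 := hcone _ (hρ _ hz').1 _ hz
    have h2 : ρ (π z) - R (Θ' (ρ (π z))) = z - R (Θ' z) := congrArg Subtype.val (hρ _ hz').2
    rw [h2, sub_self, norm_zero] at h1
    exact Subtype.ext (sub_eq_zero.1 (norm_le_zero_iff.1 h1))
  show (π z : X) + (g (π z) : X) = z
  rw [← hgeq hz']
  show (π z : X) + (γ (ρ (π z)) : X) = z
  rw [hγ]
  exact sub_add_cancel _ _

/-- A differentiable image of lower rank, from a space of dimension at most that of the target, is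
Lebesgue null. -/
theorem addHaar_image_eq_zero_of_not_surjective {P Y : Type*} [NormedAddCommGroup P]
    [NormedSpace ℝ P] [FiniteDimensional ℝ P] [NormedAddCommGroup Y] [NormedSpace ℝ Y]
    [FiniteDimensional ℝ Y] [MeasurableSpace Y] [BorelSpace Y] (ν : Measure Y) [ν.IsAddHaarMeasure]
    (hdim : Module.finrank ℝ P ≤ Module.finrank ℝ Y) {w : P → Y} {w' : P → P →L[ℝ] Y} {s : Set P}
    (hw : ∀ p ∈ s, HasFDerivWithinAt w (w' p) s p)
    (hns : ∀ p ∈ s, ¬ Function.Surjective (w' p)) : ν (w '' s) = 0 := by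
  -- Embedding `P` in `Y` with a left inverse `π` replaces `w` by `w ∘ π`, a map between equal
  -- dimensions whose derivative has determinant zero on `J '' s`; Sard's lemma then needs no
  -- smoothness beyond differentiability.
  obtain ⟨J, hJ⟩ := finrank_le_iff_exists_linearMap.1 hdim
  obtain ⟨π₀, hπ₀⟩ := J.exists_leftInverse_of_injective (LinearMap.ker_eq_bot.2 hJ)
  let π : Y →L[ℝ] P := LinearMap.toContinuousLinearMap π₀
  have hπ : ∀ p, π (J p) = p := fun p => LinearMap.congr_fun hπ₀ p
  have himg : w '' s = (fun y => w (π y)) '' (J '' s) := by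
    rw [image_image]; simp only [hπ]
  rw [himg]
  refine addHaar_image_eq_zero_of_det_fderivWithin_eq_zero ν
    (f' := fun y => (w' (π y)).comp π) ?_ ?_
  · rintro _ ⟨p, hp, rfl⟩
    refine HasFDerivWithinAt.comp (t := s) (J p) (by rw [hπ]; exact hw p hp)
      π.hasFDerivWithinAt ?_
    rintro _ ⟨q, hq, rfl⟩
    rwa [hπ]
  · rintro _ ⟨p, hp, rfl⟩
    rw [hπ]
    by_contra hdet
    refine hns p hp fun y => ?_
    obtain ⟨v, hv⟩ := (LinearMap.equivOfDetNeZero _ hdet).surjective y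
    exact ⟨π v, hv⟩

variable {F P Y : Type*} [NormedAddCommGroup F] [NormedSpace ℝ F]
  [NormedAddCommGroup P] [NormedSpace ℝ P] [FiniteDimensional ℝ P]
  [NormedAddCommGroup Y] [NormedSpace ℝ Y] [FiniteDimensional ℝ Y]

theorem IsClosed.image_fst_of_subset_prod {X K : Type*} [TopologicalSpace X] [TopologicalSpace K]
    {C : Set (X × K)} (hC : IsClosed C) {k : Set K} (hk : IsCompact k)
    (hCk : ∀ z ∈ C, z.2 ∈ k) : IsClosed (Prod.fst '' C) := by
  have : CompactSpace k := isCompact_iff_compactSpace.1 hk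
  have h : IsClosed {q : X × k | (q.1, (q.2 : K)) ∈ C} := hC.preimage (by fun_prop)
  convert isClosedMap_fst_of_compactSpace _ h using 1
  ext x
  constructor
  · rintro ⟨⟨x, p⟩, hz, rfl⟩
    exact ⟨(x, ⟨p, hCk _ hz⟩), hz, rfl⟩
  · rintro ⟨⟨x, p⟩, hz, rfl⟩
    exact ⟨(x, p), hz, rfl⟩

theorem isNullAlong_empty (D : Submodule ℝ F) : IsNullAlong D ∅ :=
  ⟨isClosed_empty, 0, 0, fun _ => D.zero_mem, fun _ => by simp⟩

/-- Implicit differentiation on an arbitrary set `s`: the Lipschitz bound at `p` turns the error of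
`Θ` into `o(q - p)`, and the linearized equation is solved for `w q - w p` by inverting `∂Θ/∂y`. -/
theorem HasFDerivAt.hasFDerivWithinAt_implicit {Θ : F × P → Y} {Θ' : F × P →L[ℝ] Y}
    {L : Y →L[ℝ] F} {f : F} {w : P → Y} {s : Set P} {p : P} {K : ℝ}
    (hΘ : HasFDerivAt Θ Θ' (f + L (w p), p)) (hzero : ∀ q ∈ s, Θ (f + L (w q), q) = 0)
    (hp : p ∈ s) (hlip : ∀ q ∈ s, ‖w q - w p‖ ≤ K * ‖q - p‖)
    (A : Y ≃L[ℝ] Y) (hA : ∀ y, A y = Θ' (L y, 0)) :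
    HasFDerivWithinAt w
      (-(A.symm.toContinuousLinearMap.comp (Θ'.comp (ContinuousLinearMap.inr ℝ F P)))) s p := by
  have hO : (fun q => w q - w p) =O[𝓝[s] p] fun q => q - p :=
    Asymptotics.IsBigO.of_bound K (eventually_mem_nhdsWithin.mono hlip)
  have hid : Tendsto (fun q => q - p) (𝓝[s] p) (𝓝 0) := by
    have : Tendsto (fun q => q - p) (𝓝 p) (𝓝 (p - p)) := tendsto_id.sub_const p
    rw [sub_self] at this
    exact this.mono_left nhdsWithin_le_nhds
  have hwt : Tendsto w (𝓝[s] p) (𝓝 (w p)) := by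
    simpa using (hO.trans_tendsto hid).add_const (w p)
  have hζ : Tendsto (fun q => (f + L (w q), q)) (𝓝[s] p) (𝓝 (f + L (w p), p)) :=
    (((L.continuous.tendsto _).comp hwt).const_add f).prodMk_nhds nhdsWithin_le_nhds
  have ho := hΘ.isLittleO.comp_tendsto hζ
  have hO2 : (fun q => ((f + L (w q), q) : F × P) - (f + L (w p), p)) =O[𝓝[s] p]
      fun q => q - p := by
    refine Asymptotics.IsBigO.prod_left ?_ (Asymptotics.isBigO_refl _ _)
    simp only [add_sub_add_left_eq_sub, ← map_sub]
    exact (L.isBigO_comp _ _).trans hO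
  have ho2 := ((A.symm.toContinuousLinearMap.isBigO_comp _ _).trans_isLittleO
    (ho.trans_isBigO hO2))
  refine HasFDerivWithinAt.of_isLittleO (ho2.neg_left.congr' ?_ EventuallyEq.rfl)
  filter_upwards [self_mem_nhdsWithin] with q hq
  simp only [Function.comp_apply, hzero q hq, hzero p hp]
  have : ((f + L (w q), q) : F × P) - (f + L (w p), p) =
      (L (w q - w p), 0) + (0, q - p) := by
    simp [map_sub]
  rw [this, map_add Θ', ← hA]
  simp

/-- In the slice `f + L y`, where `L` lifts `Y` into `D`, the nearby zeros make `y` a Lipschitz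
function `w` of `p`, with derivative `-A⁻¹ ∂Θ/∂p`. This is not onto, so the set of values of `w` is
null since `dim P ≤ dim Y`. The projection is closed because `p` ranges over a compact ball. -/
theorem HasStrictFDerivAt.exists_isNullAlong (hdim : Module.finrank ℝ P ≤ Module.finrank ℝ Y)
    {D : Submodule ℝ F} {Ω S : Set (F × P)} (hΩ : IsOpen Ω)
    (hSΩ : S ⊆ Ω) (hcl : ∀ z ∈ Ω, z ∈ closure S → z ∈ S) {Θ : F × P → Y}
    {Θ' : F × P → F × P →L[ℝ] Y} (hzero : ∀ z ∈ S, Θ z = 0)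
    (hd : ∀ z ∈ S, HasStrictFDerivAt Θ (Θ' z) z)
    (hsing : ∀ z ∈ S, ¬ Function.Surjective fun p => Θ' z (0, p))
    {z₀ : F × P} (hz₀ : z₀ ∈ S) (hD : ∀ y, ∃ h ∈ D, Θ' z₀ (h, 0) = y) :
    ∃ N ∈ 𝓝 z₀, IsNullAlong D (Prod.fst '' (S ∩ N)) := by
  borelize Y
  choose g hgD hg using hD
  let b := Module.finBasis ℝ Y
  let L : Y →L[ℝ] F := LinearMap.toContinuousLinearMap (b.constr ℝ fun i => g (b i))
  have hLD : ∀ y, L y ∈ D := fun y => by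
    show b.constr ℝ _ y ∈ D
    rw [b.constr_apply_fintype ℝ]
    exact D.sum_mem fun i _ => D.smul_mem _ (hgD _)
  have hL : ∀ y, Θ' z₀ (L y, 0) = y := fun y => by
    have : (Θ' z₀).toLinearMap ∘ₗ LinearMap.inl ℝ F P ∘ₗ L.toLinearMap = LinearMap.id :=
      b.ext fun i => by simp [L, hg]
    exact LinearMap.congr_fun this y
  have hc : (0 : ℝ) < 1 / (2 * (‖L‖ + 1)) := by positivity
  set c : ℝ := 1 / (2 * (‖L‖ + 1)) with hcdef
  have hcL : c * ‖L‖ ≤ 1 / 2 := by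
    rw [hcdef, one_div_mul_eq_div, div_le_div_iff₀ (by positivity) two_pos]
    linarith
  obtain ⟨V, hV, hlin⟩ := (hd z₀ hz₀).approximates_deriv_on_nhds (c := ⟨c, hc.le⟩) (Or.inr hc)
  obtain ⟨ε, hε, hball⟩ := Metric.nhds_basis_closedBall.mem_iff.1
    (inter_mem (interior_mem_nhds.2 hV) (hΩ.mem_nhds (hSΩ hz₀)))
  refine ⟨Metric.closedBall z₀ ε, Metric.closedBall_mem_nhds _ hε, ?_⟩
  set C := S ∩ Metric.closedBall z₀ ε with hC
  have hCclosed : IsClosed C := by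
    refine isClosed_of_closure_subset fun z hz => ?_
    have hz2 : z ∈ Metric.closedBall z₀ ε :=
      closure_minimal inter_subset_right Metric.isClosed_closedBall hz
    exact ⟨hcl z (hball hz2).2 (closure_mono inter_subset_left hz), hz2⟩
  have : ProperSpace P := FiniteDimensional.proper_real P
  refine IsNullAlong.of_finiteDimensional (Measure.addHaar : Measure Y)
    (hCclosed.image_fst_of_subset_prod (isCompact_closedBall z₀.2 ε) fun z hz =>
      (le_max_right (dist z.1 z₀.1) (dist z.2 z₀.2)).trans hz.2) L.toLinearMap hLD fun f => ?_
  -- As `Θ' z₀ ∘ L = id` and `c ‖L‖ ≤ 1/2`, half of `‖y - y'‖` is absorbed. For `p = p'` this says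
  -- that `y` is determined by `p`.
  have hest : ∀ y p y' p', (f + L y, p) ∈ C → (f + L y', p') ∈ C →
      ‖y - y'‖ ≤ 2 * (c + ‖Θ' z₀‖) * ‖p - p'‖ := by
    intro y p y' p' hz hz'
    have h1 := hlin _ (interior_subset (hball hz.2).1) _ (interior_subset (hball hz'.2).1)
    have h0 : ((f + L y, p) : F × P) - (f + L y', p') = (L (y - y'), 0) + (0, p - p') := by
      simp [map_sub]
    rw [hzero _ hz.1, hzero _ hz'.1, sub_self, zero_sub, norm_neg, h0, map_add, hL] at h1
    have h2 : ‖((L (y - y'), 0) : F × P) + (0, p - p')‖ ≤ ‖L‖ * ‖y - y'‖ + ‖p - p'‖ := by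
      refine (norm_add_le _ _).trans (add_le_add ?_ ?_)
      · rw [Prod.norm_mk, norm_zero, max_eq_left (norm_nonneg _)]; exact L.le_opNorm _
      · rw [Prod.norm_mk, norm_zero, max_eq_right (norm_nonneg _)]
    have h3 : ‖Θ' z₀ (0, p - p')‖ ≤ ‖Θ' z₀‖ * ‖p - p'‖ := by
      refine ((Θ' z₀).le_opNorm _).trans (le_of_eq ?_)
      rw [Prod.norm_mk, norm_zero, max_eq_right (norm_nonneg _)]
    have h4 : ‖y - y'‖ ≤ ‖y - y' + Θ' z₀ (0, p - p')‖ + ‖Θ' z₀ (0, p - p')‖ := by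
      simpa using norm_sub_le (y - y' + Θ' z₀ (0, p - p')) (Θ' z₀ (0, p - p'))
    have h5 : ‖y - y' + Θ' z₀ (0, p - p')‖ ≤ c * (‖L‖ * ‖y - y'‖ + ‖p - p'‖) :=
      h1.trans (mul_le_mul_of_nonneg_left h2 hc.le)
    have h6 : c * ‖L‖ * ‖y - y'‖ ≤ 1 / 2 * ‖y - y'‖ :=
      mul_le_mul_of_nonneg_right hcL (norm_nonneg _)
    linarith
  let s : Set P := {p | ∃ y, (f + L y, p) ∈ C}
  have hws : ∃ w : P → Y, ∀ p ∈ s, (f + L (w p), p) ∈ C :=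
    ⟨fun p => Classical.epsilon fun y => (f + L y, p) ∈ C, fun p hp =>
      Classical.epsilon_spec (p := fun y => (f + L y, p) ∈ C) hp⟩
  obtain ⟨w, hw⟩ := hws
  have hsub : {y | f + L.toLinearMap y ∈ Prod.fst '' C} ⊆ w '' s := by
    rintro y ⟨⟨f', p⟩, hz, hf⟩
    have hf' : f' = f + L y := hf
    subst hf'
    refine ⟨p, ⟨y, hz⟩, ?_⟩
    have := hest _ _ _ _ (hw p ⟨y, hz⟩) hz
    rw [sub_self, norm_zero, mul_zero] at this
    exact sub_eq_zero.1 (norm_le_zero_iff.1 this)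
  refine measure_mono_null hsub ?_
  have hder : ∀ p ∈ s, ∃ w' : P →L[ℝ] Y, HasFDerivWithinAt w w' s p ∧
      ¬ Function.Surjective w' := by
    intro p hp
    set z : F × P := (f + L (w p), p) with hz
    have hzC : z ∈ C := hw p hp
    have hzd : HasFDerivAt Θ (Θ' z) z := (hd z hzC.1).hasFDerivAt
    -- `Θ - Θ' z₀` is `c`-Lipschitz near `z`, so its derivative there is bounded by `c`. Hence
    -- `∂Θ/∂y` at `z` is within `1/2` of the identity, and invertible.
    have hnear : ‖Θ' z - Θ' z₀‖ ≤ c := by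
      refine (hzd.sub (Θ' z₀).hasFDerivAt).le_of_lip' hc.le ?_
      filter_upwards [mem_interior_iff_mem_nhds.1 (hball hzC.2).1] with q hq
      have := hlin _ hq _ (interior_subset (hball hzC.2).1)
      rw [map_sub] at this
      refine le_trans (le_of_eq (congrArg norm ?_)) this
      simp only [Pi.sub_apply]
      abel
    let A₀ : Y →ₗ[ℝ] Y := (Θ' z).toLinearMap ∘ₗ LinearMap.inl ℝ F P ∘ₗ L.toLinearMap
    have hA₀ : ∀ y, A₀ y = Θ' z (L y, 0) := fun y => rfl
    have hinj : Function.Injective A₀ := by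
      refine (injective_iff_map_eq_zero A₀).2 fun y hy => ?_
      have h1 : ‖(Θ' z - Θ' z₀) (L y, 0)‖ ≤ c * (‖L‖ * ‖y‖) := by
        refine ((Θ' z - Θ' z₀).le_opNorm _).trans
          (mul_le_mul hnear ?_ (norm_nonneg _) hc.le)
        rw [Prod.norm_mk, norm_zero, max_eq_left (norm_nonneg _)]
        exact L.le_opNorm _
      rw [_root_.sub_apply, ← hA₀, hy, hL, zero_sub, norm_neg, ← mul_assoc] at h1
      have h2 := mul_le_mul_of_nonneg_right hcL (norm_nonneg y)
      exact norm_le_zero_iff.1 (by linarith)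
    let A : Y ≃L[ℝ] Y := (LinearEquiv.ofInjectiveEndo A₀ hinj).toContinuousLinearEquiv
    have hA : ∀ y, A y = Θ' z (L y, 0) := fun y => rfl
    refine ⟨_, hzd.hasFDerivWithinAt_implicit (fun q hq => hzero _ (hw q hq).1) hp
      (fun q hq => hest _ _ _ _ (hw q hq) hzC) A hA, fun hsurj => hsing z hzC.1 fun y => ?_⟩
    obtain ⟨v, hv⟩ := hsurj (-A.symm y)
    refine ⟨v, A.symm.injective ?_⟩
    simpa using hv
  choose! w' hw' hns using hder
  exact addHaar_image_eq_zero_of_not_surjective _ hdim hw' hns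

theorem exists_isNullAlong_cover [SecondCountableTopology F]
    (hdim : Module.finrank ℝ P ≤ Module.finrank ℝ Y)
    {D : Submodule ℝ F} {Ω S : Set (F × P)} (hΩ : IsOpen Ω)
    (hSΩ : S ⊆ Ω) (hcl : ∀ z ∈ Ω, z ∈ closure S → z ∈ S) {Θ : F × P → Y}
    {Θ' : F × P → F × P →L[ℝ] Y} (hzero : ∀ z ∈ S, Θ z = 0)
    (hd : ∀ z ∈ S, HasStrictFDerivAt Θ (Θ' z) z)
    (hsing : ∀ z ∈ S, ¬ Function.Surjective fun p => Θ' z (0, p))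
    (hD : ∀ z ∈ S, ∀ y, ∃ h ∈ D, Θ' z (h, 0) = y) :
    ∃ T : ℕ → Set F, Prod.fst '' S ⊆ ⋃ j, T j ∧ ∀ j, IsNullAlong D (T j) := by
  have : ProperSpace P := FiniteDimensional.proper_real P
  choose! N hN hT using fun z (hz : z ∈ S) =>
    HasStrictFDerivAt.exists_isNullAlong hdim hΩ hSΩ hcl hzero hd hsing hz (hD z hz)
  obtain ⟨t, htS, htc, hcov⟩ := TopologicalSpace.countable_cover_nhdsWithin
    (fun z hz => mem_nhdsWithin_of_mem_nhds (hN z hz))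
  rcases t.eq_empty_or_nonempty with rfl | hne
  · refine ⟨fun _ => ∅, ?_, fun _ => isNullAlong_empty D⟩
    have : S = ∅ := subset_empty_iff.1 (by simpa using hcov)
    simp [this]
  · obtain ⟨u, rfl⟩ := htc.exists_eq_range hne
    refine ⟨fun j => Prod.fst '' (S ∩ N (u j)), ?_, fun j => hT _ (htS ⟨j, rfl⟩)⟩
    rintro _ ⟨z, hz, rfl⟩
    obtain ⟨_, ⟨j, rfl⟩, hj⟩ := mem_iUnion₂.1 (hcov hz)
    exact mem_iUnion.2 ⟨j, z, ⟨hz, hj⟩, rfl⟩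

end StrictZeros

/-! ### Joint regularity of `(f, x) ↦ f x` and `(f, x) ↦ df_x`. -/

/-- Strict differentiability of an evaluation map `(f, x) ↦ ev f x`, where `f ↦ ev f` is linear and
bounded for the `C¹` norm on a convex open set. -/
theorem hasStrictFDerivAt_eval {F V W : Type*} [NormedAddCommGroup F] [NormedSpace ℝ F]
    [NormedAddCommGroup V] [NormedSpace ℝ V] [NormedAddCommGroup W] [NormedSpace ℝ W]
    {ev : F → V → W} {ev' : F → V → V →L[ℝ] W} {s : Set V} (hs : IsOpen s) (hsc : Convex ℝ s)
    (hd : ∀ f, ∀ x ∈ s, HasFDerivAt (ev f) (ev' f x) x)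
    (hsub : ∀ f g, ∀ x ∈ s, ev (f - g) x = ev f x - ev g x)
    (hsub' : ∀ f g, ∀ x ∈ s, ev' (f - g) x = ev' f x - ev' g x)
    (hle : ∀ f, ∀ x ∈ s, ‖ev' f x‖ ≤ ‖f‖) {f₀ : F} {x₀ : V} (hx₀ : x₀ ∈ s)
    (hc : ContinuousAt (ev' f₀) x₀) (T : F →L[ℝ] W) (hT : ∀ h, T h = ev h x₀) :
    HasStrictFDerivAt (fun z : F × V => ev z.1 z.2)
      (T.comp (ContinuousLinearMap.fst ℝ F V) + (ev' f₀ x₀).comp (ContinuousLinearMap.snd ℝ F V))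
      (f₀, x₀) := by
  rw [hasStrictFDerivAt_iff_isLittleO, Asymptotics.isLittleO_iff]
  intro c hcpos
  obtain ⟨δ, hδ, hball⟩ := Metric.mem_nhds_iff.1 (inter_mem (hs.mem_nhds hx₀)
    (inter_mem (hc (Metric.ball_mem_nhds _ (show 0 < c / 4 by positivity)))
      (Metric.ball_mem_nhds x₀ (show 0 < c / 2 by positivity))))
  set N : Set (F × V) := Metric.ball f₀ (c / 4) ×ˢ Metric.ball x₀ δ with hN
  have hNn : N ∈ 𝓝 (f₀, x₀) :=
    prod_mem_nhds (Metric.ball_mem_nhds _ (by positivity)) (Metric.ball_mem_nhds _ hδ)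
  filter_upwards [prod_mem_nhds hNn hNn]
  rintro ⟨⟨f₁, x₁⟩, ⟨f₂, x₂⟩⟩ ⟨⟨hf₁, hx₁⟩, ⟨hf₂, hx₂⟩⟩
  -- The error splits in two: moving `f₁ - f₂` from `x₀` to `x₁`, and moving `f₂` from `x₂` to `x₁`.
  -- Each is controlled by the mean value inequality.
  have h1 : ‖ev (f₁ - f₂) x₁ - ev (f₁ - f₂) x₀‖ ≤ ‖f₁ - f₂‖ * ‖x₁ - x₀‖ :=
    hsc.norm_image_sub_le_of_norm_hasFDerivWithin_le
      (fun x hx => (hd _ x hx).hasFDerivWithinAt) (hle _) hx₀ (hball hx₁).1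
  have h2 : ‖ev f₂ x₁ - ev f₂ x₂ - ev' f₀ x₀ (x₁ - x₂)‖ ≤ c / 2 * ‖x₁ - x₂‖ := by
    refine (convex_ball x₀ δ).norm_image_sub_le_of_norm_hasFDerivWithin_le'
      (f' := ev' f₂) (fun x hx => (hd _ x (hball hx).1).hasFDerivWithinAt) (fun x hx => ?_) hx₂ hx₁
    have h3 : ev' f₂ x - ev' f₀ x₀ = ev' (f₂ - f₀) x + (ev' f₀ x - ev' f₀ x₀) := by
      rw [hsub' _ _ x (hball hx).1]; abel
    have h4 : ‖ev' f₀ x - ev' f₀ x₀‖ < c / 4 := by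
      have := (hball hx).2.1
      rwa [mem_preimage, Metric.mem_ball, dist_eq_norm] at this
    have h5 : ‖ev' (f₂ - f₀) x‖ < c / 4 :=
      (hle _ x (hball hx).1).trans_lt (by rwa [← dist_eq_norm])
    rw [h3]
    exact (norm_add_le _ _).trans (by linarith)
  have h6 : ‖x₁ - x₀‖ ≤ c / 2 := by
    rw [← dist_eq_norm]; exact (Metric.mem_ball.1 (hball hx₁).2.2).le
  have h7 : ev f₁ x₁ - ev f₂ x₂ - (T (f₁ - f₂) + ev' f₀ x₀ (x₁ - x₂)) =
      (ev (f₁ - f₂) x₁ - ev (f₁ - f₂) x₀) + (ev f₂ x₁ - ev f₂ x₂ - ev' f₀ x₀ (x₁ - x₂)) := by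
    rw [hT, hsub _ _ x₁ (hball hx₁).1]; abel
  have h8 : ‖f₁ - f₂‖ ≤ ‖((f₁, x₁) : F × V) - (f₂, x₂)‖ := le_max_left _ _
  have h9 : ‖x₁ - x₂‖ ≤ ‖((f₁, x₁) : F × V) - (f₂, x₂)‖ := le_max_right _ _
  show ‖ev f₁ x₁ - ev f₂ x₂ - (T (f₁ - f₂) + ev' f₀ x₀ (x₁ - x₂))‖ ≤ _
  rw [h7]
  have h10 : ‖f₁ - f₂‖ * ‖x₁ - x₀‖ ≤ ‖((f₁, x₁) : F × V) - (f₂, x₂)‖ * (c / 2) :=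
    mul_le_mul h8 h6 (norm_nonneg _) (norm_nonneg _)
  have h11 : c / 2 * ‖x₁ - x₂‖ ≤ c / 2 * ‖((f₁, x₁) : F × V) - (f₂, x₂)‖ :=
    mul_le_mul_of_nonneg_left h9 (by positivity)
  refine (norm_add_le _ _).trans ?_
  linarith

namespace CrSpace

variable {V W : Type} [NormedAddCommGroup V] [NormedSpace ℝ V] [ProperSpace V]
  [NormedAddCommGroup W] [NormedSpace ℝ W] {r : ℕ}

theorem hasStrictFDerivAt_toMap (hr : 1 ≤ r) (f : CrSpace V W r) {x : V}
    (hx : x ∈ Metric.ball 0 1) :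
    HasStrictFDerivAt (fun z : CrSpace V W r × V => z.1.toMap z.2)
      (((ContinuousLinearMap.fst ℝ W (V →L[ℝ] W)).comp (jetL hr hx)).comp
        (ContinuousLinearMap.fst ℝ _ V) +
        (fderiv ℝ f.toMap x).comp (ContinuousLinearMap.snd ℝ (CrSpace V W r) V)) (f, x) :=
  hasStrictFDerivAt_eval (ev := fun f : CrSpace V W r => f.toMap)
    (ev' := fun f => fderiv ℝ f.toMap) Metric.isOpen_ball (convex_ball 0 1)
    (fun f x hx => (f.differentiableAt hr hx).hasFDerivAt)
    (fun f g x _ => by rw [toMap_sub]; rfl) (fun f g x hx => fderiv_sub f g hr hx)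
    (fun f x hx => f.norm_fderiv_le hr hx) hx
    (f.contDiffAt_fderiv (k := 0) hr hx).continuousAt _ (fun h => rfl)

theorem hasStrictFDerivAt_fderiv (hr : 2 ≤ r) (f : CrSpace V W r) {x : V}
    (hx : x ∈ Metric.ball 0 1) :
    HasStrictFDerivAt (fun z : CrSpace V W r × V => fderiv ℝ z.1.toMap z.2)
      (((ContinuousLinearMap.snd ℝ W (V →L[ℝ] W)).comp (jetL (one_le_two.trans hr) hx)).comp
        (ContinuousLinearMap.fst ℝ _ V) +
        (fderiv ℝ (fderiv ℝ f.toMap) x).comp (ContinuousLinearMap.snd ℝ (CrSpace V W r) V))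
      (f, x) := by
  have hr1 : 1 ≤ r := one_le_two.trans hr
  have hd : ∀ (f : CrSpace V W r), ∀ x ∈ Metric.ball (0 : V) 1,
      DifferentiableAt ℝ (fderiv ℝ f.toMap) x := fun f x hx =>
    (f.contDiffAt_fderiv (k := 1) hr hx).differentiableAt (by simp)
  have hsub : ∀ (f g : CrSpace V W r), ∀ x ∈ Metric.ball (0 : V) 1,
      fderiv ℝ (f - g).toMap x = fderiv ℝ f.toMap x - fderiv ℝ g.toMap x :=
    fun f g x hx => fderiv_sub f g hr1 hx
  refine hasStrictFDerivAt_eval (ev := fun f : CrSpace V W r => fderiv ℝ f.toMap)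
    (ev' := fun f => fderiv ℝ (fderiv ℝ f.toMap)) Metric.isOpen_ball (convex_ball 0 1)
    (fun f x hx => (hd f x hx).hasFDerivAt) hsub (fun f g x hx => ?_)
    (fun f x hx => f.norm_fderiv_fderiv_le hr hx) hx
    ((f.contDiffAt_fderiv (k := 1) hr hx).fderiv_right (m := 0) (by simp)).continuousAt _
    (fun h => rfl)
  rw [Filter.EventuallyEq.fderiv_eq (f := fderiv ℝ f.toMap - fderiv ℝ g.toMap)
    (eventually_of_mem (Metric.isOpen_ball.mem_nhds hx) (hsub f g))]
  exact _root_.fderiv_sub (hd f x hx) (hd g x hx)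

/-- For `r = 1` this continuity replaces the strict differentiability of the derivative, and it is
enough to make the critical set relatively closed. -/
theorem continuousAt_fderiv (hr : 1 ≤ r) (f : CrSpace V W r) {x : V}
    (hx : x ∈ Metric.ball 0 1) :
    ContinuousAt (fun z : CrSpace V W r × V => fderiv ℝ z.1.toMap z.2) (f, x) := by
  have h1 : Tendsto (fun z : CrSpace V W r × V => fderiv ℝ f.toMap z.2) (𝓝 (f, x))
      (𝓝 (fderiv ℝ f.toMap x)) :=
    ((f.contDiffAt_fderiv (k := 0) hr hx).continuousAt.tendsto).comp
      (continuous_snd.tendsto (f, x))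
  have h2 : Tendsto (fun z : CrSpace V W r × V => fderiv ℝ (z.1 - f).toMap z.2) (𝓝 (f, x))
      (𝓝 0) := by
    have h3 : Tendsto (fun z : CrSpace V W r × V => ‖z.1 - f‖) (𝓝 (f, x)) (𝓝 0) := by
      have : Continuous fun z : CrSpace V W r × V => ‖z.1 - f‖ := by fun_prop
      simpa using this.tendsto (f, x)
    refine squeeze_zero_norm' ?_ h3
    filter_upwards [continuous_snd.continuousAt.preimage_mem_nhds
      (Metric.isOpen_ball.mem_nhds hx)] with z hz
    exact norm_fderiv_le _ hr hz
  have h4 := h1.add h2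
  rw [add_zero] at h4
  refine h4.congr' ?_
  filter_upwards [continuous_snd.continuousAt.preimage_mem_nhds
      (Metric.isOpen_ball.mem_nhds hx)] with z hz
  rw [fderiv_sub _ _ hr hz]
  abel

end CrSpace

/-- If `R` is a right inverse of `A`, then `det (B ∘ R) ≠ 0` for `B` near `A`. -/
theorem isOpen_surjective_continuousLinearMap {V Z : Type*} [NormedAddCommGroup V]
    [NormedSpace ℝ V] [NormedAddCommGroup Z] [NormedSpace ℝ Z] [FiniteDimensional ℝ Z] :
    IsOpen {A : V →L[ℝ] Z | Function.Surjective A} := by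
  rw [isOpen_iff_mem_nhds]
  intro A hA
  obtain ⟨R₀, hR₀⟩ := A.toLinearMap.exists_rightInverse_of_surjective (LinearMap.range_eq_top.2 hA)
  let R : Z →L[ℝ] V := LinearMap.toContinuousLinearMap R₀
  have hR : A.comp R = ContinuousLinearMap.id ℝ Z := by
    ext z; exact LinearMap.congr_fun hR₀ z
  have hcont : Continuous fun B : V →L[ℝ] Z => (B.comp R).det :=
    ContinuousLinearMap.continuous_det.comp (by fun_prop)
  have ho : IsOpen {B : V →L[ℝ] Z | (B.comp R).det ≠ 0} := isOpen_ne.preimage hcont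
  have hAR : (A.comp R).det ≠ 0 := by rw [hR]; simp [ContinuousLinearMap.det]
  refine mem_of_superset (ho.mem_nhds hAR) fun B hB z => ?_
  obtain ⟨v, hv⟩ := (LinearMap.equivOfDetNeZero _ hB).surjective z
  exact ⟨R v, hv⟩

theorem ContinuousAt.eq_zero_of_mem_closure {X Y : Type*} [TopologicalSpace X]
    [TopologicalSpace Y] [T1Space Y] [Zero Y] {Θ : X → Y} {z : X} {S : Set X} (h : ContinuousAt Θ z)
    (hS : ∀ w ∈ S, Θ w = 0) (hz : z ∈ closure S) : Θ z = 0 := by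
  have h1 := h.continuousWithinAt.mem_closure_image hz
  have h2 : closure (Θ '' S) ⊆ {0} :=
    closure_minimal (by rintro _ ⟨w, hw, rfl⟩; exact hS w hw) isClosed_singleton
  exact h2 h1

theorem exists_seq_iUnion_eq {F ι : Type*} [Countable ι] {Q : Set F → Prop} (h0 : Q ∅)
    {T : ι → Set F} (hT : ∀ i, Q (T i)) :
    ∃ T' : ℕ → Set F, ⋃ i, T i = ⋃ j, T' j ∧ ∀ j, Q (T' j) := by
  have := Encodable.ofCountable ι
  exact ⟨_, (Encodable.iUnion_decode₂ T).symm, fun j => Encodable.iUnion_decode₂_cases h0 hT⟩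

/-! ### Projections of Lipschitz graphs as Fredholm images. -/

section Fredholm

theorem isFredholm_fst {F P : Type*} [NormedAddCommGroup F] [NormedSpace ℝ F]
    [NormedAddCommGroup P] [NormedSpace ℝ P] [FiniteDimensional ℝ P] :
    (ContinuousLinearMap.fst ℝ F P).IsFredholm ∧
      (ContinuousLinearMap.fst ℝ F P : F × P →ₗ[ℝ] F).index = Module.finrank ℝ P := by
  have hker : (ContinuousLinearMap.fst ℝ F P).ker = LinearMap.range (LinearMap.inr ℝ F P) :=
    LinearMap.ker_fst ℝ F P
  have hrange : (ContinuousLinearMap.fst ℝ F P).range = ⊤ :=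
    LinearMap.range_eq_top.2 Prod.fst_surjective
  refine ⟨⟨?_, ?_, ?_, ?_, ?_⟩, ?_⟩
  · exact isOpenQuotientMap_fst.isQuotientMap.isStrictMap
  · rw [hrange]; exact isClosed_univ
  · rw [hker]; exact inferInstanceAs (FiniteDimensional ℝ (LinearMap.range _))
  · rw [hrange]; infer_instance
  · exact ContinuousLinearMap.closedComplemented_ker_of_rightInverse _
      (ContinuousLinearMap.inl ℝ F P) fun _ => rfl
  · rw [LinearMap.index_of_surjective Prod.fst_surjective]
    exact congrArg Nat.cast ((LinearEquiv.ofEq _ _ hker).finrank_eq.trans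
      (LinearMap.finrank_range_of_inj LinearMap.inr_injective))

theorem isFredholmImage_fst.{u} {F P : Type u} [NormedAddCommGroup F] [NormedSpace ℝ F]
    [CompleteSpace F] [SecondCountableTopology F] [NormedAddCommGroup P] [NormedSpace ℝ P]
    [FiniteDimensional ℝ P] {d : ℕ} {B : Set (F × P)}
    (hB : IsLipschitzGraph (d + Module.finrank ℝ P) B) : IsFredholmImage d (Prod.fst '' B) := by
  have : CompleteSpace P := FiniteDimensional.complete ℝ P
  have : ProperSpace P := FiniteDimensional.proper_real P
  refine ⟨F × P, inferInstance, inferInstance, inferInstance, inferInstance, univ, Prod.fst,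
    Module.finrank ℝ P, _, B, isOpen_univ, contDiff_fst.contDiffOn, fun x _ => ?_, subset_univ _,
    by push_cast; rfl, hB, rfl⟩
  rw [fderiv_fst]
  exact isFredholm_fst

theorem isFredholmImage_empty.{u} {F : Type u} [NormedAddCommGroup F] [NormedSpace ℝ F] (d : ℕ) :
    IsFredholmImage d (∅ : Set F) := by
  -- The index condition is vacuous on the empty domain; the value `-d` makes the required
  -- codimension `d + i` zero, as the trivial space demands.
  refine ⟨PUnit.{u + 1}, inferInstance, inferInstance, inferInstance, inferInstance, ∅, fun _ => 0,
    -d, 0, ∅, isOpen_empty, contDiffOn_const, fun x hx => hx.elim, subset_rfl, by simp,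
    ⟨⊤, ⊥, Submodule.isTopCompl_top_bot, inferInstance, by simp, 0, 0, LipschitzWith.const 0,
      empty_subset _⟩, by simp⟩

/-- The zeros have codimension `dim Y` upstairs, and the projection along `P` has index `dim P`,
which leaves codimension `d` in `F`. -/
theorem exists_isFredholmImage_cover.{u} {F P Y : Type u} [NormedAddCommGroup F] [NormedSpace ℝ F]
    [CompleteSpace F] [SecondCountableTopology F] [NormedAddCommGroup P] [NormedSpace ℝ P]
    [FiniteDimensional ℝ P] [NormedAddCommGroup Y] [NormedSpace ℝ Y] [FiniteDimensional ℝ Y]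
    {d : ℕ} (hdim : Module.finrank ℝ Y = d + Module.finrank ℝ P) {Θ : F × P → Y}
    {Θ' : F × P → F × P →L[ℝ] Y} {S : Set (F × P)} (hzero : ∀ z ∈ S, Θ z = 0)
    (hd : ∀ z ∈ S, HasStrictFDerivAt Θ (Θ' z) z) (hs : ∀ z ∈ S, Function.Surjective (Θ' z)) :
    ∃ T : ℕ → Set F, Prod.fst '' S = ⋃ j, T j ∧ ∀ j, IsFredholmImage d (T j) := by
  have : ProperSpace P := FiniteDimensional.proper_real P
  choose! N hN hT using fun z (hz : z ∈ S) => (hd z hz).exists_isLipschitzGraph (hs z hz)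
  obtain ⟨t, htS, htc, hcov⟩ := TopologicalSpace.countable_cover_nhdsWithin
    (fun z hz => mem_nhdsWithin_of_mem_nhds (hN z hz))
  have := htc.to_subtype
  obtain ⟨T, hTeq, hTQ⟩ := exists_seq_iUnion_eq (isFredholmImage_empty d)
    (T := fun i : t => Prod.fst '' (S ∩ N i)) fun i => isFredholmImage_fst <| by
      rw [← hdim]
      exact hT _ (htS i.2) _ inter_subset_right fun z hz => hzero z hz.1
  refine ⟨T, ?_, hTQ⟩
  rw [← hTeq, ← image_iUnion, ← inter_iUnion, inter_eq_left.2]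
  simpa only [iUnion_coe_set] using hcov

end Fredholm

/-! ### Critical zeros of `g ∘ f` in one chart. -/

section Chart

variable {V W Z : Type} [NormedAddCommGroup V] [NormedSpace ℝ V] [FiniteDimensional ℝ V]
  [NormedAddCommGroup W] [NormedSpace ℝ W] [FiniteDimensional ℝ W]
  [NormedAddCommGroup Z] [NormedSpace ℝ Z] [FiniteDimensional ℝ Z] {r : ℕ}

variable [ProperSpace V]

/-- The maps `f` such that `g ∘ f` has a critical zero in the open ball, at a point that `f` sends
to `U`. -/
def criticalZeroMaps (V : Type) [NormedAddCommGroup V] [NormedSpace ℝ V] [ProperSpace V] (r : ℕ)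
    (g : W → Z) (U : Set W) : Set (CrSpace V W r) :=
  {f | ∃ x ∈ Metric.ball (0 : V) 1, f.toMap x ∈ U ∧ g (f.toMap x) = 0 ∧
    ¬ Function.Surjective ((fderiv ℝ g (f.toMap x)).comp (fderiv ℝ f.toMap x))}

/-- The pairs `(f, x)` with `x` in the open ball and `f x ∈ U`. -/
def evalDomain (V : Type) [NormedAddCommGroup V] [NormedSpace ℝ V] [ProperSpace V] (r : ℕ)
    (U : Set W) : Set (CrSpace V W r × V) :=
  {z | z.2 ∈ Metric.ball (0 : V) 1 ∧ z.1.toMap z.2 ∈ U}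

theorem isOpen_evalDomain (hr : 1 ≤ r) {U : Set W} (hU : IsOpen U) :
    IsOpen (evalDomain V r U) := by
  rw [isOpen_iff_mem_nhds]
  rintro ⟨f, x⟩ ⟨hx, hfx⟩
  exact inter_mem (continuous_snd.continuousAt.preimage_mem_nhds (Metric.isOpen_ball.mem_nhds hx))
    ((CrSpace.hasStrictFDerivAt_toMap hr f hx).continuousAt.preimage_mem_nhds (hU.mem_nhds hfx))

/-- Here the unknown is `x` alone, and a critical zero is by definition a zero at which the equation
is singular in `x`. Perturbing the value of `f` at `x` suffices to reach every direction of `Z`. -/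
theorem criticalZeroMaps_cover_of_finrank_le (hr : 1 ≤ r)
    (hdim : Module.finrank ℝ V ≤ Module.finrank ℝ Z) {g : W → Z} {U : Set W} (hU : IsOpen U)
    (hg : ContDiffOn ℝ ∞ g U) (hs : ∀ y ∈ U, Function.Surjective (fderiv ℝ g y))
    {D : Submodule ℝ (CrSpace V W r)} (hD : CrSpace.JetRich hr D) :
    ∃ T : ℕ → Set (CrSpace V W r), criticalZeroMaps V r g U ⊆ ⋃ j, T j ∧
      ∀ j, IsNullAlong D (T j) := by
  let Θ : CrSpace V W r × V → Z := fun z => g (z.1.toMap z.2)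
  let Δ : CrSpace V W r × V → V →L[ℝ] Z := fun z =>
    (fderiv ℝ g (z.1.toMap z.2)).comp (fderiv ℝ z.1.toMap z.2)
  let S : Set (CrSpace V W r × V) :=
    {z ∈ evalDomain V r U | Θ z = 0 ∧ ¬ Function.Surjective (Δ z)}
  have hgat : ∀ y ∈ U, ContDiffAt ℝ ∞ g y := fun y hy => hg.contDiffAt (hU.mem_nhds hy)
  have hd : ∀ z ∈ evalDomain V r U, ∃ Θ' : CrSpace V W r × V →L[ℝ] Z,
      HasStrictFDerivAt Θ Θ' z ∧
      (∀ h, Θ' (h, 0) = fderiv ℝ g (z.1.toMap z.2) (h.toMap z.2)) ∧ ∀ v, Θ' (0, v) = Δ z v := by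
    rintro ⟨f, x⟩ ⟨hx, hfx⟩
    refine ⟨_, ((hgat _ hfx).hasStrictFDerivAt (by simp)).comp (f, x)
      (CrSpace.hasStrictFDerivAt_toMap hr f hx), fun h => by simp, fun v => ?_⟩
    have h0 : (0 : CrSpace V W r).toMap x = 0 := congrFun JetFamily.toMap_zero x
    simp [Δ, h0]
  choose! Θ' hΘ' hΘ1 hΘ2 using hd
  have hΔ : ∀ z ∈ evalDomain V r U, ContinuousAt Δ z := by
    rintro ⟨f, x⟩ ⟨hx, hfx⟩
    have h1 : ContinuousAt (fderiv ℝ g) (f.toMap x) :=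
      ((hgat _ hfx).fderiv_right (m := 0) (by simp)).continuousAt
    exact (ContinuousAt.comp (f := fun z : CrSpace V W r × V => z.1.toMap z.2) (x := (f, x)) h1
      (CrSpace.hasStrictFDerivAt_toMap hr f hx).continuousAt).clm_comp
      (CrSpace.continuousAt_fderiv hr f hx)
  have hsub : criticalZeroMaps V r g U ⊆ Prod.fst '' S := by
    rintro f ⟨x, hx, hxU, h0, hns⟩
    exact ⟨(f, x), ⟨⟨hx, hxU⟩, h0, hns⟩, rfl⟩
  suffices ∃ T : ℕ → Set (CrSpace V W r), Prod.fst '' S ⊆ ⋃ j, T j ∧ ∀ j, IsNullAlong D (T j) by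
    obtain ⟨T, hT, hTn⟩ := this
    exact ⟨T, hsub.trans hT, hTn⟩
  refine exists_isNullAlong_cover (Θ' := Θ') hdim
    (isOpen_evalDomain hr hU) (fun z hz => hz.1) (fun z hz hcl => ?_) (fun z hz => hz.2.1)
    (fun z hz => hΘ' z hz.1) (fun z hz hsurj => hz.2.2 ?_) (fun z hz y => ?_)
  · refine ⟨hz, (hΘ' z hz).continuousAt.eq_zero_of_mem_closure (fun w hw => hw.2.1) hcl, ?_⟩
    have h1 := (hΔ z hz).continuousWithinAt.mem_closure_image hcl
    exact closure_minimal (by rintro _ ⟨w, hw, rfl⟩; exact hw.2.2)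
      isOpen_surjective_continuousLinearMap.isClosed_compl h1
  · simpa only [hΘ2 z hz.1] using hsurj
  · obtain ⟨α, hα⟩ := hs _ hz.1.2 y
    obtain ⟨h, hh, hj⟩ := hD z.2 hz.1.1 (α, 0)
    refine ⟨h, hh, ?_⟩
    rw [hΘ1 z hz.1, ← hα]
    exact congrArg _ (congrArg Prod.fst hj)

theorem exists_param_ker {E : Type*} [AddCommGroup E] [Module ℝ E] [FiniteDimensional ℝ E]
    {φ : E →ₗ[ℝ] ℝ} (hφ : φ ≠ 0) :
    ∃ (k : ℕ) (ι : (Fin k → ℝ) →ₗ[ℝ] E), k + 1 = Module.finrank ℝ E ∧ (∀ q, φ (ι q) = 0) ∧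
      ∀ x, φ x = 0 → ∃ q, ι q = x := by
  let e := (Module.finBasis ℝ (LinearMap.ker φ)).equivFun
  refine ⟨_, (LinearMap.ker φ).subtype ∘ₗ e.symm.toLinearMap,
    Module.Dual.finrank_ker_add_one_of_ne_zero hφ, fun q => (e.symm q).2,
    fun x hx => ⟨e ⟨x, hx⟩, by simp⟩⟩

theorem finrank_continuousDual : Module.finrank ℝ (Z →L[ℝ] ℝ) = Module.finrank ℝ Z := by
  rw [← (LinearMap.toContinuousLinearMap (𝕜 := ℝ) (E := Z) (F' := ℝ)).finrank_eq]
  exact Subspace.dual_finrank_eq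

/-- `ι` parametrizes the covectors that vanish at `u`. -/
structure IsCovectorParam {k : ℕ} (u : Z) (ι : (Fin k → ℝ) →L[ℝ] Z →L[ℝ] ℝ) : Prop where
  finrank_eq : k + 1 = Module.finrank ℝ Z
  apply_eq_zero : ∀ q, ι q u = 0
  exists_eq : ∀ ℓ : Z →L[ℝ] ℝ, ℓ u = 0 → ∃ q, ι q = ℓ

theorem exists_isCovectorParam {u : Z} {l : Z →L[ℝ] ℝ} (hl : l u = 1) :
    ∃ (k : ℕ) (ι : (Fin k → ℝ) →L[ℝ] Z →L[ℝ] ℝ), IsCovectorParam u ι := by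
  obtain ⟨k, ι, h1, h2, h3⟩ := exists_param_ker
    (φ := (ContinuousLinearMap.apply ℝ ℝ u).toLinearMap) fun h => by
      have := LinearMap.congr_fun h l
      simp [hl] at this
  exact ⟨k, LinearMap.toContinuousLinearMap ι, h1.trans finrank_continuousDual, h2, h3⟩

/-- The system of equations saying that `x` is a zero of `g ∘ f` and that the covector `l + ι q`
annihilates the image of `d(g ∘ f)_x`. -/
def conormalEquation (V : Type) [NormedAddCommGroup V] [NormedSpace ℝ V] [ProperSpace V] (r : ℕ)
    (g : W → Z) (l : Z →L[ℝ] ℝ) {k : ℕ} (ι : (Fin k → ℝ) →L[ℝ] Z →L[ℝ] ℝ)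
    (z : CrSpace V W r × (V × (Fin k → ℝ))) : Z × (V →L[ℝ] ℝ) :=
  (g (z.1.toMap z.2.1), (l + ι z.2.2).comp
    ((fderiv ℝ g (z.1.toMap z.2.1)).comp (fderiv ℝ z.1.toMap z.2.1)))

/-- The zeros of the conormal equation over `U`. -/
def conormalZeros (V : Type) [NormedAddCommGroup V] [NormedSpace ℝ V] [ProperSpace V] (r : ℕ)
    (g : W → Z) (U : Set W) (l : Z →L[ℝ] ℝ) {k : ℕ} (ι : (Fin k → ℝ) →L[ℝ] Z →L[ℝ] ℝ) :
    Set (CrSpace V W r × (V × (Fin k → ℝ))) :=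
  {z | (z.1, z.2.1) ∈ evalDomain V r U ∧ conormalEquation V r g l ι z = 0}

variable {k : ℕ} {ι : (Fin k → ℝ) →L[ℝ] Z →L[ℝ] ℝ} {u : Z} {l : Z →L[ℝ] ℝ} {g : W → Z} {U : Set W}

/-- The equation contains `df_x`, hence `r ≥ 2`. Only the partial derivative in `f` is made
explicit: it alone gives surjectivity, and singularity in the other unknowns follows from a
dimension count. -/
theorem exists_hasStrictFDerivAt_conormalEquation (hr : 2 ≤ r)
    (hU : IsOpen U) (hg : ContDiffOn ℝ ∞ g U)
    {z : CrSpace V W r × (V × (Fin k → ℝ))} (hz : (z.1, z.2.1) ∈ evalDomain V r U) :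
    ∃ Θ' : CrSpace V W r × (V × (Fin k → ℝ)) →L[ℝ] Z × (V →L[ℝ] ℝ),
      HasStrictFDerivAt (conormalEquation V r g l ι) Θ' z ∧
      ∀ h : CrSpace V W r, Θ' (h, 0) = (fderiv ℝ g (z.1.toMap z.2.1) (h.toMap z.2.1),
        (l + ι z.2.2).comp ((fderiv ℝ g (z.1.toMap z.2.1)).comp (fderiv ℝ h.toMap z.2.1) +
          (fderiv ℝ (fderiv ℝ g) (z.1.toMap z.2.1) (h.toMap z.2.1)).comp
            (fderiv ℝ z.1.toMap z.2.1))) := by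
  obtain ⟨f, x, q⟩ := z
  obtain ⟨hx, hfx⟩ := hz
  have hgat : ContDiffAt ℝ ∞ g (f.toMap x) := hg.contDiffAt (hU.mem_nhds hfx)
  let pr : CrSpace V W r × (V × (Fin k → ℝ)) →L[ℝ] CrSpace V W r × V :=
    (ContinuousLinearMap.fst ℝ _ _).prod
      ((ContinuousLinearMap.fst ℝ _ _).comp (ContinuousLinearMap.snd ℝ _ _))
  let co : CrSpace V W r × (V × (Fin k → ℝ)) →L[ℝ] Z →L[ℝ] ℝ :=
    ι.comp ((ContinuousLinearMap.snd ℝ _ _).comp (ContinuousLinearMap.snd ℝ _ _))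
  have hpr : HasStrictFDerivAt (fun z => pr z) pr (f, x, q) := pr.hasStrictFDerivAt
  have h1 := HasStrictFDerivAt.comp (f := fun z => pr z) (f, x, q)
    (CrSpace.hasStrictFDerivAt_toMap (one_le_two.trans hr) f hx) hpr
  have h2 := HasStrictFDerivAt.comp (f := fun z => pr z) (f, x, q)
    (CrSpace.hasStrictFDerivAt_fderiv hr f hx) hpr
  have h3 := (hgat.hasStrictFDerivAt (by simp)).comp (f, x, q) h1
  have h4 := ((hgat.fderiv_right (m := 1) (by norm_cast)).hasStrictFDerivAt (by simp)).comp
    (f, x, q) h1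
  have h5 := (co.hasStrictFDerivAt (x := (f, x, q))).const_add l
  refine ⟨_, h3.prodMk (h5.clm_comp (h4.clm_comp h2)), fun h => ?_⟩
  ext <;> simp [pr, co]

/-- The value `α` of the perturbation is chosen to solve the first component. Its differential is
`b' ⊗ w` with `dg w = u`: since `l + ι q` equals `1` at `u`, this contributes exactly `b'`, which is
`b` corrected by the second-derivative term of `g`. -/
theorem conormalEquation_deriv_surjective (hr : 2 ≤ r)
    (hs : ∀ y ∈ U, Function.Surjective (fderiv ℝ g y)) (hl : l u = 1) (hι : IsCovectorParam u ι)
    {D : Submodule ℝ (CrSpace V W r)} (hD : CrSpace.JetRich (one_le_two.trans hr) D)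
    {z : CrSpace V W r × (V × (Fin k → ℝ))} (hz : (z.1, z.2.1) ∈ evalDomain V r U)
    {Θ' : CrSpace V W r × (V × (Fin k → ℝ)) →L[ℝ] Z × (V →L[ℝ] ℝ)}
    (hΘ' : ∀ h : CrSpace V W r, Θ' (h, 0) = (fderiv ℝ g (z.1.toMap z.2.1) (h.toMap z.2.1),
        (l + ι z.2.2).comp ((fderiv ℝ g (z.1.toMap z.2.1)).comp (fderiv ℝ h.toMap z.2.1) +
          (fderiv ℝ (fderiv ℝ g) (z.1.toMap z.2.1) (h.toMap z.2.1)).comp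
            (fderiv ℝ z.1.toMap z.2.1)))) (y : Z × (V →L[ℝ] ℝ)) :
    ∃ h ∈ D, Θ' (h, 0) = y := by
  obtain ⟨a, b⟩ := y
  obtain ⟨f, x, q⟩ := z
  obtain ⟨hx, hfx⟩ := hz
  obtain ⟨α, hα⟩ := hs _ hfx a
  obtain ⟨w, hw⟩ := hs _ hfx u
  have hw' : fderiv ℝ g (f.toMap x) w = u := hw
  have hq : ι q u = 0 := hι.apply_eq_zero q
  let b' : V →L[ℝ] ℝ := b - (l + ι q).comp
    ((fderiv ℝ (fderiv ℝ g) (f.toMap x) α).comp (fderiv ℝ f.toMap x))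
  obtain ⟨h, hh, hj⟩ := hD x hx (α, b'.smulRight w)
  refine ⟨h, hh, ?_⟩
  have hj1 : h.toMap x = α := congrArg Prod.fst hj
  have hj2 : fderiv ℝ h.toMap x = b'.smulRight w := congrArg Prod.snd hj
  rw [hΘ' h]
  simp only [hj1, hj2]
  refine Prod.ext hα ?_
  ext v
  simp only [ContinuousLinearMap.comp_apply, _root_.add_apply, map_add,
    ContinuousLinearMap.smulRight_apply, map_smul, hw', hl, hq, smul_eq_mul, b',
    _root_.sub_apply]
  ring

/-- The normalization of the covector removes one unknown; this excess of one equation is the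
codimension `1` of the theorem. -/
theorem IsCovectorParam.finrank_prod (hι : IsCovectorParam u ι) :
    Module.finrank ℝ (Z × (V →L[ℝ] ℝ)) = 1 + Module.finrank ℝ (V × (Fin k → ℝ)) := by
  rw [Module.finrank_prod, Module.finrank_prod, finrank_continuousDual,
    ← hι.finrank_eq, Module.finrank_fin_fun]
  ring

theorem conormalZeros_cover (hr : 2 ≤ r) (hU : IsOpen U)
    (hg : ContDiffOn ℝ ∞ g U) (hs : ∀ y ∈ U, Function.Surjective (fderiv ℝ g y))
    (hl : l u = 1) (hι : IsCovectorParam u ι) {D : Submodule ℝ (CrSpace V W r)}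
    (hD : CrSpace.JetRich (one_le_two.trans hr) D) :
    ∃ T : ℕ → Set (CrSpace V W r), Prod.fst '' conormalZeros V r g U l ι ⊆ ⋃ j, T j ∧
      ∀ j, IsNullAlong D (T j) := by
  have hr1 : 1 ≤ r := one_le_two.trans hr
  choose! Θ' hΘ' hΘ1 using fun z hz =>
    exists_hasStrictFDerivAt_conormalEquation (V := V) (l := l) (ι := ι) hr hU hg (z := z) hz
  have hfin := hι.finrank_prod (V := V)
  refine exists_isNullAlong_cover (Θ' := Θ') (by rw [hfin]; omega)
    ((isOpen_evalDomain hr1 hU).preimage (by fun_prop : Continuous fun z :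
      CrSpace V W r × (V × (Fin k → ℝ)) => (z.1, z.2.1))) (fun z hz => hz.1)
    (fun z hz hcl => ⟨hz, ?_⟩) (fun z hz => hz.2) (fun z hz => hΘ' z hz.1) (fun z hz hsurj => ?_)
    (fun z hz y => conormalEquation_deriv_surjective hr hs hl hι hD hz.1 (hΘ1 z hz.1) y)
  · exact (hΘ' z hz).continuousAt.eq_zero_of_mem_closure (fun w hw => hw.2) hcl
  -- The unknowns `(x, q)` have one dimension less than the target, so the partial derivative is
  -- never onto.
  · have := LinearMap.finrank_le_finrank_of_surjective
      (f := (Θ' z).toLinearMap ∘ₗ LinearMap.inr ℝ _ _) hsurj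
    omega

theorem conormalZeros_fredholm_cover (hr : 2 ≤ r) (hU : IsOpen U)
    (hg : ContDiffOn ℝ ∞ g U) (hs : ∀ y ∈ U, Function.Surjective (fderiv ℝ g y))
    (hl : l u = 1) (hι : IsCovectorParam u ι) :
    ∃ T : ℕ → Set (CrSpace V W r), Prod.fst '' conormalZeros V r g U l ι = ⋃ j, T j ∧
      ∀ j, IsFredholmImage 1 (T j) := by
  have : CompleteSpace W := FiniteDimensional.complete ℝ W
  choose! Θ' hΘ' hΘ1 using fun z hz =>
    exists_hasStrictFDerivAt_conormalEquation (V := V) (l := l) (ι := ι) hr hU hg (z := z) hz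
  refine exists_isFredholmImage_cover (Θ' := Θ') hι.finrank_prod
    (fun z hz => hz.2) (fun z hz => hΘ' z hz.1) fun z hz y => ?_
  obtain ⟨h, -, e⟩ := conormalEquation_deriv_surjective hr hs hl hι
    (CrSpace.jetRich_range_affine _) hz.1 (hΘ1 z hz.1) y
  exact ⟨_, e⟩

theorem fst_image_conormalZeros_subset (hl : l u = 1) (hι : IsCovectorParam u ι) :
    Prod.fst '' conormalZeros V r g U l ι ⊆ criticalZeroMaps V r g U := by
  rintro _ ⟨⟨f, x, q⟩, ⟨⟨hx, hxU⟩, h0⟩, rfl⟩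
  refine ⟨x, hx, hxU, congrArg Prod.fst h0, fun hsurj => ?_⟩
  obtain ⟨v, hv⟩ := hsurj u
  have h1 : (l + ι q) ((fderiv ℝ g (f.toMap x)).comp (fderiv ℝ f.toMap x) v) = 0 :=
    DFunLike.congr_fun (congrArg Prod.snd h0) v
  rw [hv, _root_.add_apply, hl, hι.apply_eq_zero] at h1
  simp at h1

/-- The maps `g ∘ f` with a critical zero are described by countably many conormal equations. -/
theorem exists_criticalZeroMaps_eq_iUnion (g : W → Z) (U : Set W) :
    ∃ (u : Fin (Module.finrank ℝ Z) → Z) (l : Fin (Module.finrank ℝ Z) → Z →L[ℝ] ℝ)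
      (k : Fin (Module.finrank ℝ Z) → ℕ) (ι : ∀ i, (Fin (k i) → ℝ) →L[ℝ] Z →L[ℝ] ℝ),
      (∀ i, l i (u i) = 1) ∧ (∀ i, IsCovectorParam (u i) (ι i)) ∧
      criticalZeroMaps V r g U = ⋃ i, Prod.fst '' conormalZeros V r g U (l i) (ι i) := by
  let b := Module.finBasis ℝ Z
  let l : Fin (Module.finrank ℝ Z) → Z →L[ℝ] ℝ := fun i =>
    LinearMap.toContinuousLinearMap (b.coord i)
  have hl : ∀ i, l i (b i) = 1 := fun i => by simp [l]
  choose k ι hι using fun i => exists_isCovectorParam (hl i)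
  refine ⟨b, l, k, ι, hl, hι, subset_antisymm ?_
    (iUnion_subset fun i => fst_image_conormalZeros_subset (hl i) (hι i))⟩
  rintro f ⟨x, hx, hxU, h0, hns⟩
  set A := (fderiv ℝ g (f.toMap x)).comp (fderiv ℝ f.toMap x) with hA
  have hlt : LinearMap.range A.toLinearMap < ⊤ :=
    lt_top_iff_ne_top.2 fun h => hns (LinearMap.range_eq_top.1 h)
  -- A nonzero covector annihilating the range is nonzero on some basis vector and can be rescaled
  -- to take the value `1` there: these are the standard affine charts of the projective space of
  -- covectors.
  obtain ⟨μ, hμ0, hμ⟩ := Submodule.exists_le_ker_of_lt_top _ hlt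
  obtain ⟨i, hi⟩ : ∃ i, μ (b i) ≠ 0 := by
    by_contra! h
    exact hμ0 (b.ext h)
  let lam : Z →L[ℝ] ℝ := LinearMap.toContinuousLinearMap ((μ (b i))⁻¹ • μ)
  have hlam : lam (b i) = 1 := inv_mul_cancel₀ hi
  obtain ⟨q, hq⟩ := (hι i).exists_eq (lam - l i) (by rw [_root_.sub_apply, hlam, hl, sub_self])
  refine mem_iUnion.2 ⟨i, (f, x, q), ⟨⟨hx, hxU⟩, Prod.ext h0 ?_⟩, rfl⟩
  ext v
  have hv : μ (A v) = 0 := hμ ⟨v, rfl⟩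
  show (l i + ι i q) (A v) = 0
  rw [hq, add_sub_cancel]
  show (μ (b i))⁻¹ * μ (A v) = 0
  rw [hv, mul_zero]

end Chart

/-! ### Tangent vectors and transversality in charts. -/

/-- In a chart where `A` is the zero set of a submersion `g`, the tangent space is the kernel of the
differential of `g`. -/
theorem mem_tangentVectors_iff {m : ℕ} {Z : Type*} [NormedAddCommGroup Z] [NormedSpace ℝ Z]
    [FiniteDimensional ℝ Z] {A U : Set (EuclideanSpace ℝ (Fin m))}
    {g : EuclideanSpace ℝ (Fin m) → Z} (hU : IsOpen U) (hg : ContDiffOn ℝ ∞ g U)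
    (hs : ∀ z ∈ U, Function.Surjective (fderiv ℝ g z)) (hAU : A ∩ U = {z ∈ U | g z = 0})
    {y : EuclideanSpace ℝ (Fin m)} (hyA : y ∈ A) (hyU : y ∈ U) (t : EuclideanSpace ℝ (Fin m)) :
    t ∈ tangentVectors A y ↔ fderiv ℝ g y t = 0 := by
  have hgat : ContDiffAt ℝ ∞ g y := hg.contDiffAt (hU.mem_nhds hyU)
  have hgd : HasFDerivAt g (fderiv ℝ g y) y := (hgat.differentiableAt (by simp)).hasFDerivAt
  have hgy : g y = 0 := (hAU.subset ⟨hyA, hyU⟩).2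
  constructor
  · rintro ⟨γ, hγ, h0, hγA, rfl⟩
    have hγd : HasDerivAt γ (deriv γ 0) 0 := (hγ.differentiableAt one_ne_zero).hasDerivAt
    have h1 : HasDerivAt (g ∘ γ) (fderiv ℝ g y (deriv γ 0)) 0 := by
      subst h0
      exact hgd.comp_hasDerivAt 0 hγd
    have h2 : g ∘ γ =ᶠ[𝓝 0] fun _ => 0 := by
      have hU0 : ∀ᶠ s in 𝓝 (0 : ℝ), γ s ∈ U :=
        hγ.continuousAt.preimage_mem_nhds (by rw [h0]; exact hU.mem_nhds hyU)
      filter_upwards [hγA, hU0] with s hsA hsU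
      exact (hAU.subset ⟨hsA, hsU⟩).2
    exact h1.unique ((hasDerivAt_const (0 : ℝ) (0 : Z)).congr_of_eventuallyEq h2)
  · intro ht
    set G := fderiv ℝ g y with hG
    obtain ⟨R₀, hR₀⟩ := G.toLinearMap.exists_rightInverse_of_surjective
      (LinearMap.range_eq_top.2 (hs y hyU))
    let R : Z →L[ℝ] EuclideanSpace ℝ (Fin m) := LinearMap.toContinuousLinearMap R₀
    have hR : ∀ z, G (R z) = z := fun z => LinearMap.congr_fun hR₀ z
    -- `Φ` straightens `A` near `y`: it satisfies `G (Φ z - y) = g z` and has identity derivative at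
    -- `y`. The inverse image of the line `y + s • t` is then a curve in `A` with velocity `t`.
    let Φ : EuclideanSpace ℝ (Fin m) → EuclideanSpace ℝ (Fin m) :=
      fun z => z + R (g z) - R (G (z - y))
    have hΦ : ContDiffAt ℝ ∞ Φ y := by
      refine (contDiffAt_id.add (R.contDiff.contDiffAt.comp y hgat)).sub ?_
      exact (R.contDiff.comp (G.contDiff.comp (contDiff_id.sub contDiff_const))).contDiffAt
    have hΦy : Φ y = y := by simp [Φ, hgy]
    have hΦd : HasFDerivAt Φ ((ContinuousLinearEquiv.refl ℝ (EuclideanSpace ℝ (Fin m)) :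
        EuclideanSpace ℝ (Fin m) →L[ℝ] EuclideanSpace ℝ (Fin m))) y := by
      have h1 : HasFDerivAt Φ (ContinuousLinearMap.id ℝ _ + R.comp G -
          R.comp (G.comp (ContinuousLinearMap.id ℝ _))) y :=
        ((hasFDerivAt_id y).add (R.hasFDerivAt.comp y hgd)).sub
          (R.hasFDerivAt.comp y (G.hasFDerivAt.comp y ((hasFDerivAt_id y).sub_const y)))
      convert h1 using 1
      ext v
      simp
    have hGΦ : ∀ z, G (Φ z - y) = g z := fun z => by
      have : Φ z - y = (z - y) + R (g z) - R (G (z - y)) := by simp only [Φ]; abel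
      rw [this, map_sub, map_add, hR, hR, add_sub_cancel_left]
    let e := hΦ.toOpenPartialHomeomorph Φ hΦd (by simp)
    have hesrc : y ∈ e.source := hΦ.mem_toOpenPartialHomeomorph_source hΦd (by simp)
    have hetgt : y ∈ e.target := by
      have := e.map_source hesrc
      rwa [hΦ.toOpenPartialHomeomorph_coe hΦd (by simp), hΦy] at this
    have hey : e.symm y = y := by
      have := e.left_inv hesrc
      rwa [hΦ.toOpenPartialHomeomorph_coe hΦd (by simp), hΦy] at this
    have hesymm : ContDiffAt ℝ ∞ e.symm y := by
      refine e.contDiffAt_symm hetgt (f₀' := ContinuousLinearEquiv.refl ℝ _) ?_ ?_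
      · rw [hey]; exact hΦd
      · rw [hey]; exact hΦ
    let ℓ : ℝ → EuclideanSpace ℝ (Fin m) := fun s => y + s • t
    have hℓ0 : ℓ 0 = y := by simp [ℓ]
    have hℓ : ContDiff ℝ ∞ ℓ := contDiff_const.add (contDiff_id.smul contDiff_const)
    have hγ : ContDiffAt ℝ ∞ (e.symm ∘ ℓ) 0 :=
      ContDiffAt.comp 0 (by rw [hℓ0]; exact hesymm) hℓ.contDiffAt
    have hγ0 : (e.symm ∘ ℓ) 0 = y := by simp only [Function.comp_apply, hℓ0, hey]
    have hev : ∀ᶠ s in 𝓝 (0 : ℝ), Φ (e.symm (ℓ s)) = ℓ s := by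
      have : ∀ᶠ s in 𝓝 (0 : ℝ), ℓ s ∈ e.target :=
        hℓ.continuous.continuousAt.preimage_mem_nhds
          (by rw [hℓ0]; exact e.open_target.mem_nhds hetgt)
      filter_upwards [this] with s hs'
      exact e.right_inv hs'
    refine ⟨e.symm ∘ ℓ, hγ.of_le (by simp), hγ0, ?_, ?_⟩
    · have hU0 : ∀ᶠ s in 𝓝 (0 : ℝ), (e.symm ∘ ℓ) s ∈ U :=
        hγ.continuousAt.preimage_mem_nhds (by rw [hγ0]; exact hU.mem_nhds hyU)
      filter_upwards [hev, hU0] with s hs1 hs2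
      refine (hAU.symm.subset ⟨hs2, ?_⟩).1
      show g (e.symm (ℓ s)) = 0
      rw [← hGΦ, hs1]
      simp [ℓ, ht]
    · have hγd : HasDerivAt (e.symm ∘ ℓ) (deriv (e.symm ∘ ℓ) 0) 0 :=
        (hγ.differentiableAt (by simp)).hasDerivAt
      have h1 : HasDerivAt (fun s => Φ (e.symm (ℓ s))) (deriv (e.symm ∘ ℓ) 0) 0 := by
        have hΦd' := hΦd
        rw [← hγ0] at hΦd'
        exact hΦd'.comp_hasDerivAt 0 hγd
      have h2 : HasDerivAt ℓ t 0 := by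
        have := ((hasDerivAt_id (0 : ℝ)).smul_const t).const_add y
        rwa [one_smul] at this
      exact h1.unique (h2.congr_of_eventuallyEq hev)

/-! ### Globalization over a countable atlas and conclusion. -/

section Transversality

variable {n m c r : ℕ} {A : Set (EuclideanSpace ℝ (Fin m))}

theorem transverse_at_iff_surjective {U : Set (EuclideanSpace ℝ (Fin m))}
    {g : EuclideanSpace ℝ (Fin m) → EuclideanSpace ℝ (Fin c)} (hU : IsOpen U)
    (hg : ContDiffOn ℝ ∞ g U)
    (hs : ∀ z ∈ U, Function.Surjective (fderiv ℝ g z)) (hAU : A ∩ U = {z ∈ U | g z = 0})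
    {y : EuclideanSpace ℝ (Fin m)} (hyA : y ∈ A) (hyU : y ∈ U)
    (B : EuclideanSpace ℝ (Fin n) →L[ℝ] EuclideanSpace ℝ (Fin m)) :
    (∀ w, ∃ v, ∃ t ∈ tangentVectors A y, B v + t = w) ↔
      Function.Surjective ((fderiv ℝ g y).comp B) := by
  have htan := mem_tangentVectors_iff hU hg hs hAU hyA hyU
  constructor
  · intro h z
    obtain ⟨w, rfl⟩ := hs y hyU z
    obtain ⟨v, t, ht, rfl⟩ := h w
    refine ⟨v, ?_⟩
    rw [map_add, (htan t).1 ht, add_zero, ContinuousLinearMap.comp_apply]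
  · intro h w
    obtain ⟨v, hv⟩ := h (fderiv ℝ g y w)
    refine ⟨v, w - B v, (htan _).2 ?_, by abel⟩
    rw [map_sub, ← hv, ContinuousLinearMap.comp_apply, sub_self]

/-- The non-transverse maps are described by the charts of a countable atlas. -/
theorem IsSmoothSubmanifold.exists_nonTransverse_eq_iUnion (hA : IsSmoothSubmanifold A c) :
    ∃ (t : Set (EuclideanSpace ℝ (Fin m)))
      (U : EuclideanSpace ℝ (Fin m) → Set (EuclideanSpace ℝ (Fin m)))
      (g : EuclideanSpace ℝ (Fin m) → EuclideanSpace ℝ (Fin m) → EuclideanSpace ℝ (Fin c)),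
      t.Countable ∧ (∀ y ∈ t, IsOpen (U y) ∧ ContDiffOn ℝ ∞ (g y) (U y) ∧
        ∀ z ∈ U y, Function.Surjective (fderiv ℝ (g y) z)) ∧
      nonTransverse n m r A =
        ⋃ y : t, criticalZeroMaps (EuclideanSpace ℝ (Fin n)) r (g y) (U y) := by
  choose! U g hUo hyU hg hs hAU using hA
  obtain ⟨t, htA, htc, hcov⟩ := TopologicalSpace.countable_cover_nhdsWithin
    (fun y hy => mem_nhdsWithin_of_mem_nhds ((hUo y hy).mem_nhds (hyU y hy)))
  refine ⟨t, U, g, htc, fun y hy => ⟨hUo y (htA hy), hg y (htA hy), hs y (htA hy)⟩, ?_⟩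
  ext f
  simp only [nonTransverse, IsTransverseOnBall, mem_ofPred_eq, mem_iUnion]
  constructor
  · intro h
    push Not at h
    obtain ⟨x, hx, hfA, w, hw⟩ := h
    obtain ⟨y, hyt, hfU⟩ := mem_iUnion₂.1 (hcov hfA)
    have hy := htA hyt
    refine ⟨⟨y, hyt⟩, x, hx, hfU, ((hAU y hy).subset ⟨hfA, hfU⟩).2, fun hsurj => ?_⟩
    obtain ⟨v, s, hs', e⟩ := (transverse_at_iff_surjective (hUo y hy) (hg y hy) (hs y hy)
      (hAU y hy) hfA hfU _).2 hsurj w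
    exact hw v s hs' e
  · rintro ⟨⟨y, hyt⟩, x, hx, hfU, h0, hns⟩ h
    have hy := htA hyt
    have hfA := ((hAU y hy).symm.subset ⟨hfU, h0⟩).1
    exact hns ((transverse_at_iff_surjective (hUo y hy) (hg y hy) (hs y hy)
      (hAU y hy) hfA hfU _).1 (h x hx hfA))

theorem exists_isNullAlong_cover_iUnion {F ι : Type*} [NormedAddCommGroup F] [NormedSpace ℝ F]
    [Countable ι] {D : Submodule ℝ F} {X : ι → Set F}
    (h : ∀ i, ∃ T : ℕ → Set F, X i ⊆ ⋃ j, T j ∧ ∀ j, IsNullAlong D (T j)) :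
    ∃ T : ℕ → Set F, ⋃ i, X i ⊆ ⋃ j, T j ∧ ∀ j, IsNullAlong D (T j) := by
  choose T hT hTn using h
  obtain ⟨T', hT', hn⟩ := exists_seq_iUnion_eq (isNullAlong_empty D)
    (T := fun p : ι × ℕ => T p.1 p.2) fun p => hTn p.1 p.2
  refine ⟨T', ?_, hn⟩
  rw [← hT', iUnion_prod']
  exact iUnion_mono hT

theorem isRectifiableOfCodim_iUnion {F ι : Type*} [NormedAddCommGroup F] [NormedSpace ℝ F]
    [Countable ι] {d : ℕ} {X : ι → Set F} (h : ∀ i, IsRectifiableOfCodim d (X i)) :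
    IsRectifiableOfCodim d (⋃ i, X i) := by
  choose T hTn hT using h
  obtain ⟨T', hT', hn⟩ := exists_seq_iUnion_eq (isFredholmImage_empty d)
    (T := fun p : ι × ℕ => T p.1 p.2) fun p => hTn p.1 p.2
  refine ⟨T', hn, ?_⟩
  rw [← hT', iUnion_prod']
  exact iUnion_congr hT

theorem IsSmoothSubmanifold.nonTransverse_cover (hA : IsSmoothSubmanifold A c) (hr : 1 ≤ r)
    (h : n ≤ c ∨ 2 ≤ r) {D : Submodule ℝ (CrBall n m r)} (hD : CrSpace.JetRich hr D) :
    ∃ T : ℕ → Set (CrBall n m r), nonTransverse n m r A ⊆ ⋃ j, T j ∧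
      ∀ j, IsNullAlong D (T j) := by
  obtain ⟨t, U, g, htc, hch, heq⟩ := hA.exists_nonTransverse_eq_iUnion (n := n) (r := r)
  have := htc.to_subtype
  rw [heq]
  refine exists_isNullAlong_cover_iUnion fun y => ?_
  obtain ⟨hU, hg, hs⟩ := hch y y.2
  rcases h with hnc | hr2
  · exact criticalZeroMaps_cover_of_finrank_le hr (by simpa using hnc) hU hg hs hD
  · obtain ⟨u, l, k, ι, hl, hι, heq⟩ := exists_criticalZeroMaps_eq_iUnion
      (V := EuclideanSpace ℝ (Fin n)) (r := r) (g y) (U y)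
    rw [heq]
    exact exists_isNullAlong_cover_iUnion fun i =>
      conormalZeros_cover hr2 hU hg hs (hl i) (hι i) hD

theorem IsSmoothSubmanifold.isRectifiableOfCodim_nonTransverse (hA : IsSmoothSubmanifold A c)
    (hr : 2 ≤ r) : IsRectifiableOfCodim 1 (nonTransverse n m r A) := by
  obtain ⟨t, U, g, htc, hch, heq⟩ := hA.exists_nonTransverse_eq_iUnion (n := n) (r := r)
  have := htc.to_subtype
  rw [heq]
  refine isRectifiableOfCodim_iUnion fun y => ?_
  obtain ⟨hU, hg, hs⟩ := hch y y.2
  obtain ⟨u, l, k, ι, hl, hι, heq⟩ := exists_criticalZeroMaps_eq_iUnion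
    (V := EuclideanSpace ℝ (Fin n)) (r := r) (g y) (U y)
  rw [heq]
  refine isRectifiableOfCodim_iUnion fun i => ?_
  obtain ⟨T, hT, hTn⟩ := conormalZeros_fredholm_cover (V := EuclideanSpace ℝ (Fin n)) hr hU hg hs
    (hl i) (hι i)
  exact ⟨T, hTn, hT⟩

/-- The affine maps form one finite-dimensional space of directions, enough for meagerness and Haar
nullity; Aronszajn nullity needs the cover for every dense subspace. -/
theorem IsSmoothSubmanifold.nonTransverse_small (hA : IsSmoothSubmanifold A c) (hr : 1 ≤ r)
    (h : n ≤ c ∨ 2 ≤ r) :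
    IsMeagre (nonTransverse n m r A) ∧ IsAronszajnNull (nonTransverse n m r A) ∧
      IsHaarNull (nonTransverse n m r A) := by
  obtain ⟨T, hT, hTn⟩ := hA.nonTransverse_cover hr h (CrSpace.jetRich_range_affine hr)
  exact ⟨isMeagre_of_subset_iUnion hT hTn,
    isAronszajnNull_of_subset_iUnion fun D hD =>
      hA.nonTransverse_cover hr h (CrSpace.jetRich_of_dense hr D hD),
    isHaarNull_of_subset_iUnion _ hT hTn⟩

end Transversality

end

theorem theorem1p2 (n m c r : ℕ) (A : Set (EuclideanSpace ℝ (Fin m)))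
    (hA : IsSmoothSubmanifold A c) (hr : 1 ≤ r) :
    ((r : ℤ) ≥ (n : ℤ) - c + 1 →
      IsMeagre (nonTransverse n m r A) ∧ IsAronszajnNull (nonTransverse n m r A) ∧
        IsHaarNull (nonTransverse n m r A)) ∧
    (2 ≤ r →
      (∃ d : ℕ, 1 ≤ d ∧ IsRectifiableOfCodim d (nonTransverse n m r A)) ∧
        IsMeagre (nonTransverse n m r A) ∧ IsAronszajnNull (nonTransverse n m r A)) := by
  -- If `n > c`, then `r ≥ n - c + 1 ≥ 2`.
  refine ⟨fun h => hA.nonTransverse_small hr (by omega), fun h => ?_⟩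
  obtain ⟨h1, h2, -⟩ := hA.nonTransverse_small (n := n) hr (Or.inr h)
  exact ⟨⟨1, le_rfl, hA.isRectifiableOfCodim_nonTransverse h⟩, h1, h2⟩
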